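/- Let $\mathcal C_\infty$ be the set of sequences $(z_k)_{k\in\mathbb N}$ of pairwise different complex numbers with $|z_k|\to\infty$, and let $\mathcal C_0\subset\ell_\infty$ be the set of sequences $(w_k)_{k\in\mathbb N}$ of pairwise different nonzero complex numbers with $w_k\to 0$. The group $\mathcal T$ of translations $T_b(z)=z+b$, $b\in\mathbb C$, acts on $\mathcal C_0$ by $(w_k)_k\mapsto\left(\frac{w_k}{1+bw_k}\right)_k$ whenever $1+bw_k\neq 0$ for all $k$ (this is $z_k\mapsto z_k+b$ for $z_k=1/w_k$); let $\mathcal C_0/\mathcal T$ be the space of orbits. A sequence $Z=(z_k)_k\in\mathcal C_\infty$ determines the point of $\mathcal C_0/\mathcal T$ that is the class of $\left(\frac1{z_k+b}\right)_k$, for any $b\in\mathbb C$ with $z_k+b\ne0$ for all $k$; it does not depend on $b$. Fix an integer $m\ge 2$. An infinite hyperelliptic curve is a curve $S(f,m)=\{(z,w)\in\mathbb C^2: w^m=f(z)\}$, where $f$ is an entire function whose zeros are the terms of a sequence $Z=(z_k)_k\in\mathcal C_\infty$, all of them simple; it is considered together with the enumeration $Z$ of the zeros and determines the point of $\mathcal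 C_0/\mathcal T$ given by $Z$. The complement of the points $(z_k,0)$ in $S(f,m)$ carries the translation structure lifted from $\mathbb C$ through the projection $(z,w)\mapsto z$. Its Veech group is the group of the differentials $A\in{\rm GL}_+(2,\mathbb R)$ of the orientation preserving affine diffeomorphisms, that is, of the homeomorphisms of the metric completion with respect to the flat metric that map singular points to singular points and are affine in the local coordinates of the translation structure. Then the translation structure of every infinite hyperelliptic curve $S(f,m)$ is tame: the complement of the points $(z_k,0)$ is a connected surface, and every point of the metric completion has a neighbourhood isometric to an open subset of $\mathbb C$ or to a neighbourhood of the ramification point of a cyclic branched covering of a disc of finite degree at least $2$ or of infinite degree, the latter exactly at the points that are added by the completion. Moreover, let $\mathcal U\subset\mathcal C_0/\mathcal T$ be the set of the classes that contain a sequence $(w_k)_k$ whose terms all lie on one real line of $\mathbb C$. Then $\mathcal U$ is the set of the points of $\mathcal C_0/\mathcal T$ that are determined by the infinite hyperelliptic curves $S(f,m)$ with uncountable Veech group, and its complement $(\mathcal C_0/\mathcal T)\setminus\mathcal U$ is the set of the points that are determined by the infinite hyperelliptic curves $S(f,m)$ with countable Veech group. -/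

import Mathlib

open Set Filter Topology
open scoped ENNReal

noncomputable section

/-! ## Translation atlases, the flat metric and its completion -/

/-- A translation atlas on `Y`: charts with values in `ℂ` covering `Y`, all of whose transition
maps are locally restrictions of translations of `ℂ`. -/
structure TranslationAtlas (Y : Type*) [TopologicalSpace Y] where
  /-- the charts -/
  charts : Set (OpenPartialHomeomorph Y ℂ)
  cover : ∀ p : Y, ∃ e ∈ charts, p ∈ e.source
  compat : ∀ e ∈ charts, ∀ e' ∈ charts, ∀ p : Y, p ∈ e.source → p ∈ e'.source →
    ∃ b : ℂ, ∀ᶠ q in 𝓝 p, e' q = e q + b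

/-- The translation atlas lifted from `ℂ` through a local homeomorphism `D : Y → ℂ`: its charts
are all the local restrictions of `D` that are homeomorphisms onto open sets. -/
def IsLocalHomeomorph.translationAtlas {Y : Type*} [TopologicalSpace Y] {D : Y → ℂ}
    (hD : IsLocalHomeomorph D) : TranslationAtlas Y where
  charts := {e | ∀ p ∈ e.source, e p = D p}
  cover p := by
    obtain ⟨e, hp, he⟩ := hD p
    exact ⟨e, fun q _ => by rw [he], hp⟩
  compat e he e' he' p hp hp' := by
    refine ⟨0, ?_⟩
    filter_upwards [e.open_source.mem_nhds hp, e'.open_source.mem_nhds hp'] with q hq hq'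
    rw [he q hq, he' q hq', add_zero]

namespace TranslationAtlas

variable {Y : Type*} [TopologicalSpace Y]

/-- `p` and `q` are joined by a path `γ : [0, 1] → Y` which is `C¹` in the charts, with velocity
`v` (the velocity read in a chart does not depend on the chart), and whose length in the flat
Riemannian metric (the pull-back of the metric of `ℂ`) is `ℓ`. -/
def C1Joined (𝒜 : TranslationAtlas Y) (p q : Y) (ℓ : ℝ) : Prop :=
  ∃ (γ : ℝ → Y) (v : ℝ → ℂ), ContinuousOn γ (Icc 0 1) ∧ ContinuousOn v (Icc 0 1) ∧
    γ 0 = p ∧ γ 1 = q ∧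
    (∀ t ∈ Icc (0 : ℝ) 1, ∀ e ∈ 𝒜.charts, γ t ∈ e.source →
      HasDerivWithinAt (fun s => e (γ s)) (v t) (Icc 0 1) t) ∧
    ℓ = ∫ t in (0 : ℝ)..1, ‖v t‖

/-- `p` and `q` are joined by a piecewise `C¹` path (a finite concatenation of `C¹` paths) of
length `ℓ`. -/
inductive PiecewiseJoined (𝒜 : TranslationAtlas Y) : Y → Y → ℝ → Prop
  | refl (p : Y) : PiecewiseJoined 𝒜 p p 0
  | cons {p q r : Y} {ℓ ℓ' : ℝ} :
      C1Joined 𝒜 p q ℓ → PiecewiseJoined 𝒜 q r ℓ' → PiecewiseJoined 𝒜 p r (ℓ + ℓ')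

/-- The distance of the flat Riemannian metric: the infimum of the lengths of the piecewise `C¹`
paths from `p` to `q` (it is `∞` if there is none). -/
def flatEDist (𝒜 : TranslationAtlas Y) (p q : Y) : ℝ≥0∞ :=
  ⨅ (ℓ : ℝ) (_ : PiecewiseJoined 𝒜 p q ℓ), ENNReal.ofReal ℓ

theorem C1Joined.symm {𝒜 : TranslationAtlas Y} {p q : Y} {ℓ : ℝ} (h : C1Joined 𝒜 p q ℓ) :
    C1Joined 𝒜 q p ℓ := by
  obtain ⟨γ, v, hγ, hv, h0, h1, hd, hl⟩ := h
  have hm : MapsTo (fun t : ℝ => 1 - t) (Icc 0 1) (Icc 0 1) := fun t ht =>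
    ⟨by linarith [ht.2], by linarith [ht.1]⟩
  have hc : Continuous fun t : ℝ => 1 - t := by fun_prop
  refine ⟨fun t => γ (1 - t), fun t => -v (1 - t), hγ.comp hc.continuousOn hm,
    (hv.comp hc.continuousOn hm).neg, by simpa using h1, by simpa using h0, ?_, ?_⟩
  · intro t ht e he hs
    have h2 : HasDerivWithinAt (fun s : ℝ => 1 - s) (-1) (Icc 0 1) t := by
      simpa using ((hasDerivAt_id t).const_sub 1).hasDerivWithinAt
    have h3 := (hd (1 - t) (hm ht) e he hs).scomp t h2 hm
    simpa [Function.comp_def] using h3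
  · rw [hl]
    have := intervalIntegral.integral_comp_sub_left (a := 0) (b := 1) (fun t => ‖v t‖) (1 : ℝ)
    simp only [norm_neg]
    rw [this]
    norm_num

theorem C1Joined.nonneg {𝒜 : TranslationAtlas Y} {p q : Y} {ℓ : ℝ} (h : C1Joined 𝒜 p q ℓ) :
    0 ≤ ℓ := by
  obtain ⟨γ, v, -, -, -, -, -, hl⟩ := h
  rw [hl]
  exact intervalIntegral.integral_nonneg zero_le_one fun t _ => norm_nonneg _

theorem PiecewiseJoined.nonneg {𝒜 : TranslationAtlas Y} {p q : Y} {ℓ : ℝ}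
    (h : PiecewiseJoined 𝒜 p q ℓ) : 0 ≤ ℓ := by
  induction h with
  | refl p => exact le_rfl
  | cons h _ ih => exact add_nonneg h.nonneg ih

theorem PiecewiseJoined.trans {𝒜 : TranslationAtlas Y} {p q r : Y} {ℓ ℓ' : ℝ}
    (h : PiecewiseJoined 𝒜 p q ℓ) (h' : PiecewiseJoined 𝒜 q r ℓ') :
    PiecewiseJoined 𝒜 p r (ℓ + ℓ') := by
  induction h with
  | refl p => simpa using h'
  | cons h₁ _ ih => rw [add_assoc]; exact .cons h₁ (ih h')

theorem PiecewiseJoined.symm {𝒜 : TranslationAtlas Y} {p q : Y} {ℓ : ℝ}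
    (h : PiecewiseJoined 𝒜 p q ℓ) : PiecewiseJoined 𝒜 q p ℓ := by
  induction h with
  | refl p => exact .refl p
  | @cons p q r ℓ ℓ' h₁ _ ih =>
    have h2 : PiecewiseJoined 𝒜 q p (ℓ + 0) := .cons h₁.symm (.refl p)
    have h3 := ih.trans h2
    have h4 : ℓ' + (ℓ + 0) = ℓ + ℓ' := by ring
    rwa [h4] at h3

theorem flatEDist_self (𝒜 : TranslationAtlas Y) (p : Y) : 𝒜.flatEDist p p = 0 :=
  le_antisymm (iInf₂_le_of_le 0 (.refl p) (by simp)) bot_le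

theorem flatEDist_comm (𝒜 : TranslationAtlas Y) (p q : Y) :
    𝒜.flatEDist p q = 𝒜.flatEDist q p :=
  le_antisymm (le_iInf₂ fun ℓ h => iInf₂_le ℓ h.symm) (le_iInf₂ fun ℓ h => iInf₂_le ℓ h.symm)

theorem flatEDist_triangle (𝒜 : TranslationAtlas Y) (p q r : Y) :
    𝒜.flatEDist p r ≤ 𝒜.flatEDist p q + 𝒜.flatEDist q r := by
  unfold flatEDist
  simp_rw [ENNReal.iInf_add, ENNReal.add_iInf]
  refine le_iInf₂ fun ℓ h => le_iInf₂ fun ℓ' h' => ?_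
  rw [← ENNReal.ofReal_add h.nonneg h'.nonneg]
  exact iInf₂_le _ (h.trans h')

/-- A copy of `Y` that carries the flat metric. -/
structure FlatSpace (𝒜 : TranslationAtlas Y) where
  /-- the underlying point of `Y` -/
  pt : Y

/-- The flat metric, cut off at `1` so that it is real-valued without any connectedness
assumption. Neither the uniform structure (hence the completion) nor the distances smaller
than `1` (hence the local isometry type) are affected by the cut-off. -/
instance (𝒜 : TranslationAtlas Y) : PseudoMetricSpace 𝒜.FlatSpace where
  dist p q := (min (𝒜.flatEDist p.pt q.pt) 1).toReal
  dist_self p := by simp [flatEDist_self]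
  dist_comm p q := by rw [flatEDist_comm]
  dist_triangle p q r := by
    have hne : ∀ a : ℝ≥0∞, min a 1 ≠ ∞ := fun a =>
      ne_top_of_le_ne_top ENNReal.one_ne_top (min_le_right _ _)
    rw [← ENNReal.toReal_add (hne _) (hne _)]
    refine ENNReal.toReal_mono (ENNReal.add_ne_top.2 ⟨hne _, hne _⟩) ?_
    have h := 𝒜.flatEDist_triangle p.pt q.pt r.pt
    rcases le_total (𝒜.flatEDist p.pt q.pt) 1 with h1 | h1
    · rcases le_total (𝒜.flatEDist q.pt r.pt) 1 with h2 | h2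
      · rw [min_eq_left h1, min_eq_left h2]
        exact (min_le_left _ _).trans h
      · rw [min_eq_right h2]
        exact (min_le_right _ _).trans le_add_self
    · rw [min_eq_right h1]
      exact (min_le_right _ _).trans le_self_add

/-- The metric completion of `Y` with respect to the flat metric. -/
abbrev MetricCompletion (𝒜 : TranslationAtlas Y) : Type _ :=
  UniformSpace.Completion 𝒜.FlatSpace

/-- The canonical map from `Y` to the metric completion. -/
def toCompletion (𝒜 : TranslationAtlas Y) (p : Y) : 𝒜.MetricCompletion :=
  ((⟨p⟩ : 𝒜.FlatSpace) : UniformSpace.Completion 𝒜.FlatSpace)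

/-- The singularities: the points of the metric completion outside the domain `Y` of the
translation atlas. -/
def sing (𝒜 : TranslationAtlas Y) : Set 𝒜.MetricCompletion := (range 𝒜.toCompletion)ᶜ

end TranslationAtlas

/-- An open neighbourhood of `x` is isometric to an open neighbourhood of `a`, by an isometry that
takes `x` to `a`. -/
def LocallyIsometricAt {M N : Type*} [MetricSpace M] [MetricSpace N] (x : M) (a : N) : Prop :=
  ∃ (U : Set M) (V : Set N) (φ : U ≃ᵢ V) (hx : x ∈ U),
    IsOpen U ∧ IsOpen V ∧ (φ ⟨x, hx⟩ : N) = a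

/-! ## Plane curves `w ^ m = f z` -/

/-- The affine plane curve `S(f, m) = {(z, w) : w ^ m = f z}`. -/
def planeCurve (f : ℂ → ℂ) (m : ℕ) : Set (ℂ × ℂ) := {p | p.2 ^ m = f p.1}

/-- `S(f, m)` without the points `(z, 0)`, where `z` runs over the zeros of `f`. -/
def regularPart (f : ℂ → ℂ) (m : ℕ) : Set (ℂ × ℂ) := planeCurve f m \ {p | p.2 = 0}

/-- The projection `(z, w) ↦ z` restricted to the regular part. -/
def curveProj (f : ℂ → ℂ) (m : ℕ) (p : regularPart f m) : ℂ := p.1.1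

theorem isLocalHomeomorph_curveProj {f : ℂ → ℂ} (hf : Continuous f) {m : ℕ} (hm : m ≠ 0) :
    IsLocalHomeomorph (curveProj f m) := by
  intro p
  have hder : HasStrictDerivAt (fun w : ℂ => w ^ m) ((m : ℂ) * p.1.2 ^ (m - 1)) p.1.2 :=
    hasStrictDerivAt_pow m p.1.2
  have hne : (m : ℂ) * p.1.2 ^ (m - 1) ≠ 0 :=
    mul_ne_zero (Nat.cast_ne_zero.2 hm) (pow_ne_zero _ p.2.2)
  have hF := hder.hasStrictFDerivAt_equiv hne
  obtain ⟨e, he, hpe⟩ : ∃ e : OpenPartialHomeomorph ℂ ℂ,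
      (∀ w, e w = w ^ m) ∧ p.1.2 ∈ e.source :=
    ⟨hF.toOpenPartialHomeomorph _, fun w => rfl, hF.mem_toOpenPartialHomeomorph_source⟩
  have hpow : ∀ z, f z ∈ e.target → e.symm (f z) ^ m = f z := fun z hz => by
    rw [← he, e.right_inv hz]
  have hreg : ∀ z, f z ∈ e.target → f z ≠ 0 → (z, e.symm (f z)) ∈ regularPart f m := by
    intro z hz hz0
    refine ⟨hpow z hz, fun h0 => hz0 ?_⟩
    have h0' : e.symm (f z) = 0 := h0
    rw [← hpow z hz, h0', zero_pow hm]
  classical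
  refine ⟨{
    toFun := curveProj f m
    invFun := fun z => if h : f z ∈ e.target ∧ f z ≠ 0 then
      ⟨(z, e.symm (f z)), hreg z h.1 h.2⟩ else p
    source := {q | q.1.2 ∈ e.source}
    target := {z | f z ∈ e.target ∧ f z ≠ 0}
    map_source' := ?_
    map_target' := ?_
    left_inv' := ?_
    right_inv' := ?_
    open_source := e.open_source.preimage (continuous_snd.comp continuous_subtype_val)
    open_target := (e.open_target.preimage hf).inter (isOpen_ne.preimage hf)
    continuousOn_toFun := (continuous_fst.comp continuous_subtype_val).continuousOn
    continuousOn_invFun := ?_ }, hpe, rfl⟩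
  · intro q hq
    have hq1 : q.1.2 ^ m = f q.1.1 := q.2.1
    change f q.1.1 ∈ e.target ∧ f q.1.1 ≠ 0
    rw [← hq1]
    exact ⟨he q.1.2 ▸ e.map_source hq, pow_ne_zero _ q.2.2⟩
  · intro z hz
    have hz' : f z ∈ e.target ∧ f z ≠ 0 := hz
    simp only [mem_ofPred_eq, dif_pos hz']
    exact e.map_target hz'.1
  · intro q hq
    have hq1 : q.1.2 ^ m = f q.1.1 := q.2.1
    have hz : f (curveProj f m q) ∈ e.target ∧ f (curveProj f m q) ≠ 0 := by
      change f q.1.1 ∈ e.target ∧ f q.1.1 ≠ 0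
      rw [← hq1]
      exact ⟨he q.1.2 ▸ e.map_source hq, pow_ne_zero _ q.2.2⟩
    simp only [dif_pos hz]
    refine Subtype.ext (Prod.ext rfl ?_)
    change e.symm (f q.1.1) = q.1.2
    rw [← hq1, ← he, e.left_inv hq]
  · intro z hz
    have hz' : f z ∈ e.target ∧ f z ≠ 0 := hz
    simp only [dif_pos hz']
    rfl
  · rw [Topology.IsInducing.subtypeVal.continuousOn_iff]
    have hc : ContinuousOn (fun z => (z, e.symm (f z))) {z | f z ∈ e.target ∧ f z ≠ 0} :=
      continuousOn_id.prodMk (e.continuousOn_symm.comp hf.continuousOn fun z hz => hz.1)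
    refine hc.congr fun z hz => ?_
    have hz' : f z ∈ e.target ∧ f z ≠ 0 := hz
    simp only [Function.comp_apply, dif_pos hz']

/-- The translation atlas on the regular part of `S(f, m)` lifted from `ℂ` through the
projection `(z, w) ↦ z`. -/
def curveAtlas (f : ℂ → ℂ) (hf : Continuous f) (m : ℕ) (hm : m ≠ 0) :
    TranslationAtlas (regularPart f m) :=
  (isLocalHomeomorph_curveProj hf hm).translationAtlas

/-! ## Cone points and tame translation surfaces -/

/-- The cyclic branched covering of degree `n` of the plane, branched at `0`: it is
`{(z, w) : w ^ n = z} → ℂ`, `(z, w) ↦ z`. The only point that the metric completion adds to its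
regular part is the ramification point. -/
def cyclicCoverAtlas (n : ℕ) (hn : n ≠ 0) : TranslationAtlas (regularPart id n) :=
  curveAtlas id continuous_id n hn

theorem isLocalHomeomorph_cexp : IsLocalHomeomorph Complex.exp := by
  rw [isLocalHomeomorph_iff_isLocalHomeomorphOn_univ]
  refine IsLocalHomeomorphOn.mk _ _ fun x _ => ?_
  have h := (Complex.hasStrictDerivAt_exp x).hasStrictFDerivAt_equiv (Complex.exp_ne_zero x)
  exact ⟨h.toOpenPartialHomeomorph _, h.mem_toOpenPartialHomeomorph_source, fun y _ => rfl⟩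

/-- The infinite cyclic covering `exp : ℂ → ℂ \ {0}` of the punctured plane. The only point that
the metric completion adds to it is the (infinite) ramification point. -/
def infiniteCyclicCoverAtlas : TranslationAtlas ℂ := isLocalHomeomorph_cexp.translationAtlas

namespace TranslationAtlas

variable {Y : Type*} [TopologicalSpace Y]

/-- `x` has a neighbourhood isometric to an open subset of `ℂ`. -/
def IsFlatPoint (𝒜 : TranslationAtlas Y) (x : 𝒜.MetricCompletion) : Prop :=
  ∃ a : ℂ, LocallyIsometricAt x a

/-- `x` is a finite cone angle singularity of angle `2nπ`: it has a neighbourhood isometric to a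
neighbourhood of the ramification point of a cyclic branched covering of degree `n`. -/
def IsConePoint (𝒜 : TranslationAtlas Y) (n : ℕ) (x : 𝒜.MetricCompletion) : Prop :=
  ∃ (hn : n ≠ 0), ∃ a ∈ (cyclicCoverAtlas n hn).sing, LocallyIsometricAt x a

/-- `x` is an infinite cone angle singularity. -/
def IsInfiniteConePoint (𝒜 : TranslationAtlas Y) (x : 𝒜.MetricCompletion) : Prop :=
  ∃ a ∈ infiniteCyclicCoverAtlas.sing, LocallyIsometricAt x a

/-- The translation atlas `𝒜` makes (the metric completion of) the surface `Y` a tame translation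
surface: `Y` is a surface (connected, Hausdorff, second countable; the atlas makes it locally
Euclidean), every point of `Y` is flat, and every other point of the metric completion is a cone
angle singularity, of angle `2nπ` with `n ≥ 2` (so that it is not removable) or infinite. -/
structure IsTame (𝒜 : TranslationAtlas Y) : Prop where
  connected : ConnectedSpace Y
  hausdorff : T2Space Y
  secondCountable : SecondCountableTopology Y
  flat : ∀ x ∉ 𝒜.sing, 𝒜.IsFlatPoint x
  cone : ∀ x ∈ 𝒜.sing, (∃ n, 2 ≤ n ∧ 𝒜.IsConePoint n x) ∨ 𝒜.IsInfiniteConePoint x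

/-! ## The Veech group -/

/-- The action of a matrix on `ℂ`, identified with `ℝ²` through the basis `1, i`. -/
def matAct (A : Matrix (Fin 2) (Fin 2) ℝ) : ℂ →ₗ[ℝ] ℂ :=
  Matrix.toLin Complex.basisOneI Complex.basisOneI A

/-- `h` is an affine diffeomorphism of the translation surface with differential `A`: a
homeomorphism of the metric completion that maps singularities to singularities, restricts to a
homeomorphism `g` of `Y`, and has in all local coordinates the form `z ↦ A z + b` (with `b`
locally constant). -/
def IsAffineDiffeo (𝒜 : TranslationAtlas Y) (A : Matrix (Fin 2) (Fin 2) ℝ)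
    (h : 𝒜.MetricCompletion ≃ₜ 𝒜.MetricCompletion) : Prop :=
  h '' 𝒜.sing = 𝒜.sing ∧
  ∃ g : Y ≃ₜ Y, (∀ p, h (𝒜.toCompletion p) = 𝒜.toCompletion (g p)) ∧
    ∀ p : Y, ∀ e ∈ 𝒜.charts, ∀ e' ∈ 𝒜.charts, p ∈ e.source → g p ∈ e'.source →
      ∃ b : ℂ, ∀ᶠ q in 𝓝 p, e' (g q) = matAct A (e q) + b

/-- The Veech group: the group of the matrices of positive determinant that are the differential
of an (orientation preserving) affine diffeomorphism. -/
def veechGroup (𝒜 : TranslationAtlas Y) : Subgroup (Matrix.GLPos (Fin 2) ℝ) where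
  carrier := {A | ∃ h, 𝒜.IsAffineDiffeo (A : GL (Fin 2) ℝ) h}
  one_mem' := by
    refine ⟨Homeomorph.refl _, by simp, Homeomorph.refl _, fun p => rfl, ?_⟩
    intro p e he e' he' hp hp'
    obtain ⟨b, hb⟩ := 𝒜.compat e he e' he' p hp hp'
    exact ⟨b, by simpa [matAct] using hb⟩
  mul_mem' := by
    rintro A B ⟨h, hs, g, hg, ha⟩ ⟨h', hs', g', hg', ha'⟩
    refine ⟨h'.trans h, ?_, g'.trans g, fun p => by simp [hg', hg], ?_⟩
    · change (h ∘ h') '' 𝒜.sing = 𝒜.sing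
      rw [image_comp, hs', hs]
    · intro p e he e'' he'' hp hp''
      obtain ⟨e', he', hp'⟩ := 𝒜.cover (g' p)
      obtain ⟨b', hb'⟩ := ha' p e he e' he' hp hp'
      obtain ⟨b, hb⟩ := ha (g' p) e' he' e'' he'' hp' hp''
      refine ⟨matAct ((A : GL (Fin 2) ℝ) : Matrix _ _ ℝ) b' + b, ?_⟩
      filter_upwards [hb', g'.continuous.continuousAt.eventually hb] with q h1 h2
      have h3 : matAct (((A * B : Matrix.GLPos (Fin 2) ℝ) : GL (Fin 2) ℝ) : Matrix _ _ ℝ) (e q)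
          = matAct ((A : GL (Fin 2) ℝ) : Matrix _ _ ℝ)
            (matAct ((B : GL (Fin 2) ℝ) : Matrix _ _ ℝ) (e q)) := by
        simp [matAct, Matrix.toLin_mul Complex.basisOneI Complex.basisOneI Complex.basisOneI]
      simp only [Homeomorph.trans_apply]
      rw [h2, h1, h3, map_add, add_assoc]
  inv_mem' := by
    rintro A ⟨h, hs, g, hg, ha⟩
    refine ⟨h.symm, ?_, g.symm, ?_, ?_⟩
    · conv_lhs => rw [← hs]
      rw [← image_comp]
      simp
    · intro p
      rw [Homeomorph.symm_apply_eq, hg]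
      simp
    · intro p e he e' he' hp hp'
      obtain ⟨b, hb⟩ := ha (g.symm p) e' he' e he hp' (by simpa using hp)
      refine ⟨-matAct (((A⁻¹ : Matrix.GLPos (Fin 2) ℝ) : GL (Fin 2) ℝ) : Matrix _ _ ℝ) b, ?_⟩
      filter_upwards [g.symm.continuous.continuousAt.eventually hb] with q h1
      have h3 : ∀ z, matAct (((A⁻¹ : Matrix.GLPos (Fin 2) ℝ) : GL (Fin 2) ℝ) : Matrix _ _ ℝ)
          (matAct ((A : GL (Fin 2) ℝ) : Matrix _ _ ℝ) z) = z := by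
        intro z
        rw [matAct, matAct, ← LinearMap.comp_apply, ← Matrix.toLin_mul]
        have : (((A⁻¹ : Matrix.GLPos (Fin 2) ℝ) : GL (Fin 2) ℝ) : Matrix (Fin 2) (Fin 2) ℝ)
            * ((A : GL (Fin 2) ℝ) : Matrix (Fin 2) (Fin 2) ℝ) = 1 := by
          rw [← Units.val_mul, ← Subgroup.coe_mul]
          simp
        rw [this]
        simp
      simp only [Homeomorph.apply_symm_apply] at h1
      rw [h1, map_add, h3]
      ring

end TranslationAtlas

/-! ## The spaces of sequences and the moduli space -/

/-- `𝒞_∞`: the sequences of pairwise different complex numbers that converge to infinity. -/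
def CInfty : Set (ℕ → ℂ) :=
  {Z | Function.Injective Z ∧ Tendsto (fun k => ‖Z k‖) atTop atTop}

/-- `𝒞₀`: the subspace of `ℓ_∞` of the sequences of pairwise different nonzero complex numbers
that converge to zero. -/
def CZero : Set (lp (fun _ : ℕ => ℂ) ∞) :=
  {w | Function.Injective (fun k => w k) ∧ (∀ k, w k ≠ 0) ∧ Tendsto (fun k => w k) atTop (𝓝 0)}

/-- `w` and `w'` are in the same orbit of the group of translations `T_b(z) = z + b`, which acts
on `𝒞₀` by `w_k ↦ w_k / (1 + b w_k)` wherever all the denominators are different from `0`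
(that is, by `z_k ↦ z_k + b` on `z_k = 1 / w_k`). -/
def SameOrbit (w w' : CZero) : Prop :=
  ∃ b : ℂ, ∀ k, 1 + b * w.1 k ≠ 0 ∧ w'.1 k = w.1 k / (1 + b * w.1 k)

theorem sameOrbit_iff (w w' : CZero) :
    SameOrbit w w' ↔ ∃ b : ℂ, ∀ k, (w'.1 k)⁻¹ = (w.1 k)⁻¹ + b := by
  refine exists_congr fun b => forall_congr' fun k => ?_
  have hw := w.2.2.1 k
  have hw' := w'.2.2.1 k
  constructor
  · rintro ⟨h1, h2⟩
    rw [h2]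
    field_simp
  · intro h
    have h3 : 1 + b * w.1 k = w.1 k * (w'.1 k)⁻¹ := by
      rw [h]
      field_simp
    have h4 : 1 + b * w.1 k ≠ 0 := by
      rw [h3]
      exact mul_ne_zero hw (inv_ne_zero hw')
    refine ⟨h4, ?_⟩
    rw [h3]
    field_simp

/-- The orbit equivalence relation of the translations on `𝒞₀`. -/
instance orbitSetoid : Setoid CZero where
  r := SameOrbit
  iseqv :=
    { refl := fun w => (sameOrbit_iff w w).2 ⟨0, fun k => by simp⟩
      symm := fun {w w'} h => by
        obtain ⟨b, hb⟩ := (sameOrbit_iff w w').1 h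
        exact (sameOrbit_iff w' w).2 ⟨-b, fun k => by rw [hb k]; ring⟩
      trans := fun {w w' w''} h h' => by
        obtain ⟨b, hb⟩ := (sameOrbit_iff w w').1 h
        obtain ⟨b', hb'⟩ := (sameOrbit_iff w' w'').1 h'
        exact (sameOrbit_iff w w'').2 ⟨b + b', fun k => by rw [hb' k, hb k]; ring⟩ }

/-- The quotient space `𝒞₀ / 𝒯` (with the quotient topology). -/
abbrev ModuliSpace : Type := Quotient orbitSetoid

theorem CInfty.exists_representative (Z : CInfty) :
    ∃ w : CZero, ∃ b : ℂ, ∀ k, (w.1 k)⁻¹ = Z.1 k + b := by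
  obtain ⟨b, hb⟩ : ∃ b : ℂ, b ∉ range fun k => -Z.1 k := by
    by_contra! hcon
    exact not_countable_complex ((countable_range _).mono fun b _ => hcon b)
  have hne : ∀ k, Z.1 k + b ≠ 0 := fun k h => hb ⟨k, by linear_combination -h⟩
  have hlim : Tendsto (fun k => (Z.1 k + b)⁻¹) atTop (𝓝 0) := by
    refine tendsto_inv₀_cobounded.comp ?_
    rw [← tendsto_norm_atTop_iff_cobounded]
    refine tendsto_atTop_mono (f := fun k => ‖Z.1 k‖ - ‖b‖) (fun k => ?_)
      (tendsto_atTop_add_const_right _ _ Z.2.2)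
    have := norm_sub_le (Z.1 k + b) b
    rw [add_sub_cancel_right] at this
    linarith
  have hbdd : BddAbove (range fun k => ‖(Z.1 k + b)⁻¹‖) := hlim.norm.bddAbove_range
  refine ⟨⟨⟨fun k => (Z.1 k + b)⁻¹, memℓp_infty hbdd⟩, ?_, ?_, hlim⟩, b, fun k => inv_inv _⟩
  · intro j k hjk
    exact Z.2.1 (add_right_cancel (inv_injective hjk))
  · intro k
    exact inv_ne_zero (hne k)

/-- The point of `𝒞₀ / 𝒯` given by a sequence `Z` in `𝒞_∞`: the class of the sequence
`(1 / (z_k + b))_k`, for any `b` such that no `z_k + b` is `0`. -/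
def CInfty.moduliClass (Z : CInfty) : ModuliSpace := ⟦(CInfty.exists_representative Z).choose⟧

theorem CInfty.mk_eq_moduliClass_iff (Z : CInfty) (w : CZero) :
    (⟦w⟧ : ModuliSpace) = CInfty.moduliClass Z ↔ ∃ b : ℂ, ∀ k, (w.1 k)⁻¹ = Z.1 k + b := by
  obtain ⟨b₀, hb₀⟩ := (CInfty.exists_representative Z).choose_spec
  rw [CInfty.moduliClass, Quotient.eq]
  change SameOrbit _ _ ↔ _
  rw [sameOrbit_iff]
  constructor
  · rintro ⟨b, hb⟩
    exact ⟨b₀ - b, fun k => by linear_combination hb₀ k - hb k⟩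
  · rintro ⟨b, hb⟩
    exact ⟨b₀ - b, fun k => by linear_combination hb₀ k - hb k⟩

/-- `𝒰`: the classes `[(w_k)_k]` in `𝒞₀ / 𝒯` of the sequences whose terms are collinear. -/
def collinearClasses : Set ModuliSpace :=
  {c | ∃ w : CZero, ⟦w⟧ = c ∧ Collinear ℝ (range fun k => w.1 k)}

/-! ## Infinite hyperelliptic curves -/

/-- `f` is a function of Weierstrass associated to the sequence `Z`: an entire function whose
zeros are the terms of `Z`, all of them simple. -/
structure IsWeierstrassFunction (f : ℂ → ℂ) (Z : ℕ → ℂ) : Prop where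
  entire : Differentiable ℂ f
  zeros : ∀ z, f z = 0 ↔ z ∈ range Z
  simple : ∀ k, deriv f (Z k) ≠ 0

/-- An infinite hyperelliptic curve `S(f, m)`, where `m ≥ 2` and `f` is a function of Weierstrass
associated to a sequence `Z` in `𝒞_∞`. -/
structure InfiniteHyperellipticCurve (m : ℕ) where
  /-- the sequence of zeros -/
  Z : CInfty
  /-- the function of Weierstrass -/
  f : ℂ → ℂ
  isWeierstrass : IsWeierstrassFunction f Z.1
  two_le : 2 ≤ m

namespace InfiniteHyperellipticCurve

variable {m : ℕ}

/-- The translation structure of `S(f, m)`, lifted through `(z, w) ↦ z` to the complement of the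
points `(z_k, 0)`. -/
def atlas (S : InfiniteHyperellipticCurve m) : TranslationAtlas (regularPart S.f m) :=
  curveAtlas S.f S.isWeierstrass.entire.continuous m (by have := S.two_le; omega)

/-- The point of the moduli space `𝒞₀ / 𝒯` given by the curve. -/
def moduliClass (S : InfiniteHyperellipticCurve m) : ModuliSpace := CInfty.moduliClass S.Z

/-- The Veech group of the curve. -/
abbrev veechGroup (S : InfiniteHyperellipticCurve m) : Subgroup (Matrix.GLPos (Fin 2) ℝ) :=
  S.atlas.veechGroup

end InfiniteHyperellipticCurve

end

/-! Tameness is local. Where `f` does not vanish, a continuous `m`-th root of `f` gives sections of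
`(z, w) ↦ z` over a disc. They are isometric onto neighbourhoods in the flat metric, so the
completion adds points only over zeros. At a zero `a`, simplicity gives `f z = (z - a) * μ z ^ m`
with `μ` continuous and nonvanishing, and `(z, w) ↦ (z - a, w / μ z)` identifies the curve near `a`
with the cyclic covering of degree `m` by local isometries. All added points are therefore cone
points of degree `m`. The curve is connected because the complement of the countable zero set is
connected and all sheets are already joined around one simple zero.

By connectedness an affine diffeomorphism covers a single map `z ↦ A z + b`, and this map sends
zeros of `f` to zeros. If the zeros are not collinear, the indices of the images of three of them
determine `A`, so the Veech group is countable (`countable_veechGroup`). If they lie on a real line,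
every shear fixing that line pointwise preserves the complement of the zeros. Integrating the
logarithmic derivative of `f` along the flow lines of the shears yields a continuous branch of `log
(f z_t / f z)`, which lifts each shear to the curve. The Veech group then contains a one-parameter
group of shears (`uncountable_veechGroup`).

The dichotomy thus depends on the zeros alone. A collinear null sequence spans a line through `0`,
and inversion maps such lines to such lines, so membership in `𝒰` means collinear zeros. Weierstrass
products realise every class by a curve, which turns the equivalence into the two equalities of
sets. -/

noncomputable section

/-! ## Existence of functions of Weierstrass -/

/-- The factor `(1 + x) exp (-(x - x² / 2 + ⋯ ± x ^ k / k))` of a Weierstrass product. -/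
def weierstrassFactor (k : ℕ) (x : ℂ) : ℂ := (1 + x) * Complex.exp (-Complex.logTaylor (k + 1) x)

/-- A logarithm of the Weierstrass factor. -/
def weierstrassLog (k : ℕ) (x : ℂ) : ℂ := Complex.log (1 + x) - Complex.logTaylor (k + 1) x

theorem one_add_mem_slitPlane {x : ℂ} (hx : ‖x‖ < 1) : 1 + x ∈ Complex.slitPlane :=
  Complex.mem_slitPlane_of_norm_lt_one hx

theorem exp_weierstrassLog (k : ℕ) {x : ℂ} (hx : ‖x‖ < 1) :
    Complex.exp (weierstrassLog k x) = weierstrassFactor k x := by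
  rw [weierstrassLog, weierstrassFactor, sub_eq_add_neg, Complex.exp_add,
    Complex.exp_log (Complex.slitPlane_ne_zero (one_add_mem_slitPlane hx))]

/-- The Taylor remainder of order `k` is geometrically small in `k`, uniformly in `x`. Hence the
product converges however slowly the zeros tend to infinity. -/
theorem norm_weierstrassLog_le (k : ℕ) {x : ℂ} (hx : ‖x‖ ≤ 1 / 2) :
    ‖weierstrassLog k x‖ ≤ (1 / 2) ^ k := by
  refine (Complex.norm_log_sub_logTaylor_le k (by linarith)).trans ?_
  have h1 : (1 - ‖x‖)⁻¹ ≤ 2 := by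
    rw [inv_le_comm₀ (by linarith) (by norm_num)]
    linarith
  have h2 : ‖x‖ ^ (k + 1) ≤ (1 / 2) ^ (k + 1) := pow_le_pow_left₀ (norm_nonneg _) hx _
  have h0 : (0 : ℝ) ≤ (1 - ‖x‖)⁻¹ := inv_nonneg.2 (by linarith)
  calc ‖x‖ ^ (k + 1) * (1 - ‖x‖)⁻¹ / (k + 1)
      ≤ ‖x‖ ^ (k + 1) * (1 - ‖x‖)⁻¹ :=
        div_le_self (by positivity) (by linarith [(Nat.cast_nonneg k : (0 : ℝ) ≤ k)])
    _ ≤ (1 / 2) ^ (k + 1) * 2 := by gcongr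
    _ = (1 / 2) ^ k := by ring

theorem differentiable_logTaylor (k : ℕ) : Differentiable ℂ (Complex.logTaylor (k + 1)) :=
  fun z => (Complex.hasDerivAt_logTaylor k z).differentiableAt

/-- On a disc about `0`, the Weierstrass product is a finite product of linear factors up to
a holomorphic factor without zeros. -/
theorem exists_eq_prod_mul {a : ℕ → ℂ}
    (ha : Tendsto (fun k => ‖a k‖) atTop atTop) (R : ℝ) (hR : 0 < R) :
    ∃ (N : ℕ) (h : ℂ → ℂ), (∀ k, N ≤ k → R ≤ ‖a k‖) ∧ DifferentiableOn ℂ h (Metric.ball 0 R) ∧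
      (∀ z, h z ≠ 0) ∧
      ∀ z ∈ Metric.ball (0 : ℂ) R, ∏' k, weierstrassFactor k (-z / a k) =
        (∏ k ∈ Finset.range N, (1 - z / a k)) * h z := by
  -- The factor `2` forces `‖z / a k‖ ≤ 1 / 2` on the disc, so the tail is the exponential of a
  -- convergent series of logarithms.
  obtain ⟨N, hN⟩ := eventually_atTop.1 (ha.eventually_ge_atTop (2 * R))
  have hx : ∀ z ∈ Metric.ball (0 : ℂ) R, ∀ k, ‖-z / a (k + N)‖ ≤ 1 / 2 := by
    intro z hz k
    have h1 := hN (k + N) (by omega)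
    rw [mem_ball_zero_iff] at hz
    rw [norm_div, norm_neg, div_le_iff₀ (by linarith)]
    linarith
  have hu : Summable fun k : ℕ => ((1 : ℝ) / 2) ^ (k + N) :=
    (summable_nat_add_iff N).2 summable_geometric_two
  have hG : DifferentiableOn ℂ (fun z => ∑' k, weierstrassLog (k + N) (-z / a (k + N)))
      (Metric.ball 0 R) := by
    refine Complex.differentiableOn_tsum_of_summable_norm hu (fun k => ?_) Metric.isOpen_ball
      fun k z hz => norm_weierstrassLog_le _ (hx z hz k)
    intro z hz
    have h1 : DifferentiableAt ℂ (weierstrassLog (k + N)) (-z / a (k + N)) := by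
      refine DifferentiableAt.sub (DifferentiableAt.clog (by fun_prop) ?_)
        (differentiable_logTaylor _ _)
      exact one_add_mem_slitPlane ((hx z hz k).trans_lt (by norm_num))
    exact (h1.comp z (f := fun z => -z / a (k + N)) (by fun_prop)).differentiableWithinAt
  refine ⟨N, fun z => (∏ k ∈ Finset.range N, Complex.exp (-Complex.logTaylor (k + 1) (-z / a k))) *
    Complex.exp (∑' k, weierstrassLog (k + N) (-z / a (k + N))), fun k hk => ?_, ?_, ?_, ?_⟩
  · linarith [hN k hk]
  · refine DifferentiableOn.mul (Differentiable.differentiableOn ?_) hG.cexp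
    refine Differentiable.fun_finsetProd fun k _ => ?_
    exact ((differentiable_logTaylor k).comp (by fun_prop)).neg.cexp
  · exact fun z => mul_ne_zero (Finset.prod_ne_zero_iff.2 fun k _ => Complex.exp_ne_zero _)
      (Complex.exp_ne_zero _)
  · intro z hz
    have hs : Summable fun k => weierstrassLog (k + N) (-z / a (k + N)) :=
      Summable.of_norm_bounded hu fun k => norm_weierstrassLog_le _ (hx z hz k)
    have hp : HasProd (fun k => weierstrassFactor (k + N) (-z / a (k + N)))
        (Complex.exp (∑' k, weierstrassLog (k + N) (-z / a (k + N)))) := by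
      convert hs.hasSum.cexp using 2 with k
      exact (exp_weierstrassLog _ ((hx z hz k).trans_lt (by norm_num))).symm
    have h1 := Multipliable.prod_mul_tprod_nat_mul' (f := fun k => weierstrassFactor k (-z / a k))
      (k := N) hp.multipliable
    rw [← h1, hp.tprod_eq, ← mul_assoc, ← Finset.prod_mul_distrib]
    congr 1
    refine Finset.prod_congr rfl fun k _ => ?_
    rw [weierstrassFactor, neg_div, ← sub_eq_add_neg]

/-- All three properties are local, so they can be read off the finite factorisation on a disc of
radius slightly larger than the modulus of the point considered. -/
theorem exists_isWeierstrassFunction_of_ne_zero {a : ℕ → ℂ} (ha0 : ∀ k, a k ≠ 0)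
    (hinj : Function.Injective a) (ha : Tendsto (fun k => ‖a k‖) atTop atTop) :
    ∃ f, IsWeierstrassFunction f a := by
  refine ⟨fun z => ∏' k, weierstrassFactor k (-z / a k), ?_, ?_, ?_⟩
  · intro z
    obtain ⟨N, h, -, hd, -, he⟩ := exists_eq_prod_mul ha (‖z‖ + 1) (by positivity)
    have hz : Metric.ball (0 : ℂ) (‖z‖ + 1) ∈ 𝓝 z :=
      Metric.isOpen_ball.mem_nhds (by rw [mem_ball_zero_iff]; linarith)
    refine DifferentiableAt.congr_of_eventuallyEq ?_ (eventuallyEq_of_mem hz he)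
    refine DifferentiableAt.mul ?_ (hd.differentiableAt hz)
    exact (Differentiable.fun_finsetProd fun k _ => by fun_prop) z
  · intro z
    obtain ⟨N, h, hN, hd, h0, he⟩ := exists_eq_prod_mul ha (‖z‖ + 1) (by positivity)
    simp only [he z (by rw [mem_ball_zero_iff]; linarith)]
    rw [mul_eq_zero, or_iff_left (h0 z), Finset.prod_eq_zero_iff]
    constructor
    · rintro ⟨k, -, hk⟩
      refine ⟨k, ?_⟩
      rw [sub_eq_zero, eq_comm, div_eq_one_iff_eq (ha0 k)] at hk
      exact hk.symm
    · rintro ⟨k, rfl⟩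
      refine ⟨k, ?_, by rw [div_self (ha0 k), sub_self]⟩
      by_contra hk
      have := hN k (by simpa using hk)
      linarith
  · intro j
    obtain ⟨N, h, hN, hd, h0, he⟩ := exists_eq_prod_mul ha (‖a j‖ + 1) (by positivity)
    have hz : Metric.ball (0 : ℂ) (‖a j‖ + 1) ∈ 𝓝 (a j) :=
      Metric.isOpen_ball.mem_nhds (by rw [mem_ball_zero_iff]; linarith)
    have hj : j ∈ Finset.range N := by
      by_contra hk
      have := hN j (by simpa using hk)
      linarith
    -- Isolating the factor that vanishes at `a j` leaves one surviving term in the product rule. It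
    -- is nonzero because the `a k` are distinct.
    have he' : (fun z => ∏' k, weierstrassFactor k (-z / a k)) =ᶠ[𝓝 (a j)]
        fun z => (1 - z / a j) * ((∏ k ∈ (Finset.range N).erase j, (1 - z / a k)) * h z) := by
      filter_upwards [hz] with z hz
      rw [he z hz, ← Finset.mul_prod_erase _ _ hj, mul_assoc]
    rw [he'.deriv_eq]
    have h1 : HasDerivAt (fun z => 1 - z / a j) (-(1 / a j)) (a j) :=
      ((hasDerivAt_id (a j)).div_const (a j)).const_sub 1
    have h2 : DifferentiableAt ℂ
        (fun z => (∏ k ∈ (Finset.range N).erase j, (1 - z / a k)) * h z) (a j) := by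
      refine DifferentiableAt.mul ?_ (hd.differentiableAt hz)
      exact (Differentiable.fun_finsetProd fun k _ => by fun_prop) _
    rw [(h1.fun_mul h2.hasDerivAt).deriv, div_self (ha0 j), sub_self, zero_mul, add_zero]
    refine mul_ne_zero (neg_ne_zero.2 (one_div_ne_zero (ha0 j))) (mul_ne_zero ?_ (h0 _))
    refine Finset.prod_ne_zero_iff.2 fun k hk hk0 => (Finset.mem_erase.1 hk).1 ?_
    rw [sub_eq_zero, eq_comm, div_eq_one_iff_eq (ha0 k)] at hk0
    exact (hinj hk0).symm

theorem tendsto_norm_add_const_atTop {Z : ℕ → ℂ} (hZ : Tendsto (fun k => ‖Z k‖) atTop atTop)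
    (b : ℂ) : Tendsto (fun k => ‖Z k + b‖) atTop atTop := by
  refine tendsto_atTop_mono (f := fun k => ‖Z k‖ - ‖b‖) (fun k => ?_)
    (tendsto_atTop_add_const_right _ _ hZ)
  have := norm_sub_le (Z k + b) b
  rw [add_sub_cancel_right] at this
  linarith

/-- A translation moves the sequence away from `0`, where the factors `1 - z / a k` make no sense.
-/
theorem exists_isWeierstrassFunction (Z : CInfty) : ∃ f, IsWeierstrassFunction f Z.1 := by
  obtain ⟨w, b, hb⟩ := CInfty.exists_representative Z
  have hne : ∀ k, Z.1 k + b ≠ 0 := fun k => by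
    rw [← hb]
    exact inv_ne_zero (w.2.2.1 k)
  have hlim := tendsto_norm_add_const_atTop Z.2.2 b
  obtain ⟨f, hf⟩ := exists_isWeierstrassFunction_of_ne_zero hne
    (fun j k h => Z.2.1 (add_right_cancel h)) hlim
  refine ⟨fun z => f (z + b), hf.entire.comp (by fun_prop), fun z => ?_, fun k => ?_⟩
  · rw [hf.zeros]
    simp
  · rw [deriv_comp_add_const]
    exact hf.simple k

/-! ## The flat metric of a translation atlas lifted through a local homeomorphism -/

namespace IsLocalHomeomorph

variable {Y X : Type*} [TopologicalSpace Y] [TopologicalSpace X] {D : Y → ℂ} {E : X → ℂ}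

/-- For a lifted atlas `D` serves as a global coordinate, so velocities need no choice of chart. -/
theorem c1Joined_iff (hD : IsLocalHomeomorph D) {p q : Y} {ℓ : ℝ} :
    hD.translationAtlas.C1Joined p q ℓ ↔
      ∃ (γ : ℝ → Y) (v : ℝ → ℂ), ContinuousOn γ (Icc 0 1) ∧ ContinuousOn v (Icc 0 1) ∧
        γ 0 = p ∧ γ 1 = q ∧
        (∀ t ∈ Icc (0 : ℝ) 1, HasDerivWithinAt (fun s => D (γ s)) (v t) (Icc 0 1) t) ∧
        ℓ = ∫ t in (0 : ℝ)..1, ‖v t‖ := by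
  constructor
  · rintro ⟨γ, v, hγ, hv, h0, h1, hd, hl⟩
    refine ⟨γ, v, hγ, hv, h0, h1, fun t ht => ?_, hl⟩
    obtain ⟨e, he, rfl⟩ := hD (γ t)
    exact hd t ht e (fun _ _ => rfl) he
  · rintro ⟨γ, v, hγ, hv, h0, h1, hd, hl⟩
    refine ⟨γ, v, hγ, hv, h0, h1, fun t ht e he hs => ?_, hl⟩
    refine (hd t ht).congr_of_eventuallyEq ?_ (he _ hs)
    filter_upwards [(hγ t ht).eventually (e.open_source.mem_nhds hs)] with s hs'
    exact he _ hs'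

/-- Needed at every time `t`, not only at the endpoint: it keeps the projection of a short path
inside a given disc. -/
theorem norm_sub_le_integral {f v : ℝ → ℂ} (hv : ContinuousOn v (Icc 0 1))
    (hd : ∀ t ∈ Icc (0 : ℝ) 1, HasDerivWithinAt f (v t) (Icc 0 1) t) {t : ℝ}
    (ht : t ∈ Icc (0 : ℝ) 1) : ‖f t - f 0‖ ≤ ∫ t in (0 : ℝ)..1, ‖v t‖ := by
  have hsub : Icc 0 t ⊆ Icc (0 : ℝ) 1 := Icc_subset_Icc_right ht.2
  have hi : IntervalIntegrable v MeasureTheory.volume 0 t :=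
    (hv.mono hsub).intervalIntegrable_of_Icc ht.1
  have h1 := intervalIntegral.integral_eq_sub_of_hasDerivAt_of_le ht.1
    (fun s hs => (hd s (hsub hs)).continuousWithinAt.mono hsub)
    (fun s hs => (hd s (hsub (Ioo_subset_Icc_self hs))).hasDerivAt
      (Icc_mem_nhds hs.1 (hs.2.trans_le ht.2))) hi
  rw [← h1]
  refine (intervalIntegral.norm_integral_le_integral_norm ht.1).trans ?_
  exact intervalIntegral.integral_mono_interval le_rfl ht.1 ht.2
    (MeasureTheory.ae_of_all _ fun _ => norm_nonneg _) (hv.norm.intervalIntegrable_of_Icc zero_le_one)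

theorem norm_sub_le_of_c1Joined (hD : IsLocalHomeomorph D) {p q : Y} {ℓ : ℝ}
    (h : hD.translationAtlas.C1Joined p q ℓ) : ‖D q - D p‖ ≤ ℓ := by
  obtain ⟨γ, v, -, hv, rfl, rfl, hd, rfl⟩ := hD.c1Joined_iff.1 h
  exact norm_sub_le_integral hv hd (right_mem_Icc.2 zero_le_one)

theorem norm_sub_le_of_piecewiseJoined (hD : IsLocalHomeomorph D) {p q : Y} {ℓ : ℝ}
    (h : hD.translationAtlas.PiecewiseJoined p q ℓ) : ‖D q - D p‖ ≤ ℓ := by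
  induction h with
  | refl p => simp
  | @cons p q r ℓ ℓ' h _ ih =>
    have h1 := hD.norm_sub_le_of_c1Joined h
    have h2 := norm_sub_le_norm_sub_add_norm_sub (D r) (D q) (D p)
    linarith

theorem ofReal_norm_sub_le_flatEDist (hD : IsLocalHomeomorph D) (p q : Y) :
    ENNReal.ofReal ‖D q - D p‖ ≤ hD.translationAtlas.flatEDist p q :=
  le_iInf₂ fun _ h => ENNReal.ofReal_le_ofReal (hD.norm_sub_le_of_piecewiseJoined h)

/-- A map that is continuous over a disc and affine in the local coordinates maps short paths to
paths. -/
theorem piecewiseJoined_map (hD : IsLocalHomeomorph D) (hE : IsLocalHomeomorph E)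
    (L : ℂ →L[ℝ] ℂ) {K : ℝ} (hK : ∀ z, ‖L z‖ ≤ K * ‖z‖) {Ψ : Y → X} {b c : ℂ} {r : ℝ}
    (hΨ : ContinuousOn Ψ {p | ‖D p - c‖ < r})
    (hL : ∀ p, ‖D p - c‖ < r → E (Ψ p) = L (D p) + b) {p q : Y} {ℓ : ℝ}
    (h : hD.translationAtlas.PiecewiseJoined p q ℓ) (hp : ‖D p - c‖ + ℓ < r) :
    ∃ ℓ' ≤ K * ℓ, hE.translationAtlas.PiecewiseJoined (Ψ p) (Ψ q) ℓ' := by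
  induction h with
  | refl p => exact ⟨0, by simp, .refl _⟩
  | @cons p q s ℓ ℓ' h h' ih =>
    have h1 := hD.norm_sub_le_of_c1Joined h
    have h2 := norm_sub_le_norm_sub_add_norm_sub (D q) (D p) c
    obtain ⟨ℓ'', hl'', hj⟩ := ih (by linarith)
    obtain ⟨γ, v, hγ, hv, rfl, rfl, hd, hl⟩ := hD.c1Joined_iff.1 h
    have hin : ∀ t ∈ Icc (0 : ℝ) 1, ‖D (γ t) - c‖ < r := by
      intro t ht
      have h3 := norm_sub_le_integral hv hd ht
      rw [← hl] at h3
      have h4 := norm_sub_le_norm_sub_add_norm_sub (D (γ t)) (D (γ 0)) c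
      linarith [h'.nonneg]
    have hLv : ContinuousOn (fun t => L (v t)) (Icc 0 1) := L.continuous.comp_continuousOn hv
    have hj1 : hE.translationAtlas.C1Joined (Ψ (γ 0)) (Ψ (γ 1))
        (∫ t in (0 : ℝ)..1, ‖L (v t)‖) := by
      refine hE.c1Joined_iff.2 ⟨fun t => Ψ (γ t), fun t => L (v t), hΨ.comp hγ hin, hLv, rfl, rfl,
        fun t ht => ?_, rfl⟩
      have h5 := (L.hasFDerivAt.comp_hasDerivWithinAt t (hd t ht)).add_const b
      exact h5.congr (fun s hs => hL _ (hin s hs)) (hL _ (hin t ht))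
    refine ⟨_, ?_, .cons hj1 hj⟩
    rw [mul_add, hl, ← intervalIntegral.integral_const_mul]
    refine add_le_add ?_ hl''
    exact intervalIntegral.integral_mono_on zero_le_one
      (hLv.norm.intervalIntegrable_of_Icc zero_le_one)
      ((hv.norm.const_mul K).intervalIntegrable_of_Icc zero_le_one) fun t _ => hK _

theorem flatEDist_map_le (hD : IsLocalHomeomorph D) (hE : IsLocalHomeomorph E)
    (L : ℂ →L[ℝ] ℂ) {K : ℝ} (hK0 : 0 ≤ K) (hK : ∀ z, ‖L z‖ ≤ K * ‖z‖) {Ψ : Y → X} {b c : ℂ} {r δ : ℝ}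
    (hΨ : ContinuousOn Ψ {p | ‖D p - c‖ < r})
    (hL : ∀ p, ‖D p - c‖ < r → E (Ψ p) = L (D p) + b) {p q : Y}
    (hp : ‖D p - c‖ + δ ≤ r) (hd : hD.translationAtlas.flatEDist p q < ENNReal.ofReal δ) :
    hE.translationAtlas.flatEDist (Ψ p) (Ψ q) ≤
      ENNReal.ofReal K * hD.translationAtlas.flatEDist p q := by
  set d := hD.translationAtlas.flatEDist p q with hd'
  -- The infimum of lengths need not be attained, so the bound is proved for every `x > d` and
  -- passed to the limit.
  have : (𝓝[>] d).NeBot := nhdsGT_neBot_of_exists_gt ⟨_, hd⟩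
  have ht : Tendsto (fun x => ENNReal.ofReal K * x) (𝓝[>] d) (𝓝 (ENNReal.ofReal K * d)) :=
    (ENNReal.Tendsto.const_mul tendsto_id (Or.inr ENNReal.ofReal_ne_top)).mono_left
      nhdsWithin_le_nhds
  refine ge_of_tendsto ht ?_
  filter_upwards [self_mem_nhdsWithin] with x hx
  have hx' : d < min x (ENNReal.ofReal δ) := lt_min hx hd
  rw [hd', TranslationAtlas.flatEDist] at hx'
  simp only [iInf_lt_iff] at hx'
  obtain ⟨ℓ, hj, hl⟩ := hx'
  have hl1 := hl.trans_le (min_le_right _ _)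
  rw [ENNReal.ofReal_lt_ofReal_iff'] at hl1
  obtain ⟨ℓ', hl', hj'⟩ := hD.piecewiseJoined_map hE L hK hΨ hL hj (by linarith [hl1.1])
  calc _ ≤ ENNReal.ofReal ℓ' := iInf₂_le ℓ' hj'
    _ ≤ ENNReal.ofReal (K * ℓ) := ENNReal.ofReal_le_ofReal hl'
    _ = ENNReal.ofReal K * ENNReal.ofReal ℓ := ENNReal.ofReal_mul hK0
    _ ≤ _ := by gcongr; exact hl.le.trans (min_le_left _ _)

/-- The case of a translation. -/
theorem flatEDist_map_le_of_translation (hD : IsLocalHomeomorph D) (hE : IsLocalHomeomorph E)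
    {Ψ : Y → X} {b c : ℂ} {r δ : ℝ} (hΨ : ContinuousOn Ψ {p | ‖D p - c‖ < r})
    (hL : ∀ p, ‖D p - c‖ < r → E (Ψ p) = D p + b) {p q : Y}
    (hp : ‖D p - c‖ + δ ≤ r) (hd : hD.translationAtlas.flatEDist p q < ENNReal.ofReal δ) :
    hE.translationAtlas.flatEDist (Ψ p) (Ψ q) ≤ hD.translationAtlas.flatEDist p q := by
  simpa using hD.flatEDist_map_le hE (ContinuousLinearMap.id ℝ ℂ) zero_le_one (by simp) hΨ
    (by simpa using hL) hp hd

/-! ### Sections over discs -/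

/-- Uniqueness of lifts: a short path and the section applied to its projection lift the same plane
path from the same point. -/
theorem eq_section_of_piecewiseJoined [T2Space Y] (hD : IsLocalHomeomorph D) {s : ℂ → Y} {c : ℂ}
    {r : ℝ} (hs : ContinuousOn s (Metric.ball c r)) (hDs : ∀ z ∈ Metric.ball c r, D (s z) = z)
    {p q : Y} {ℓ : ℝ} (h : hD.translationAtlas.PiecewiseJoined p q ℓ)
    (hp : ‖D p - c‖ + ℓ < r) (hps : p = s (D p)) : q = s (D q) := by
  induction h with
  | refl p => exact hps
  | @cons p q s ℓ ℓ' h h' ih =>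
    have h1 := hD.norm_sub_le_of_c1Joined h
    have h2 := norm_sub_le_norm_sub_add_norm_sub (D q) (D p) c
    refine ih (by linarith) ?_
    obtain ⟨γ, v, hγ, hv, rfl, rfl, hd, hl⟩ := hD.c1Joined_iff.1 h
    have hin : ∀ t ∈ Icc (0 : ℝ) 1, D (γ t) ∈ Metric.ball c r := by
      intro t ht
      have h3 := norm_sub_le_integral hv hd ht
      rw [← hl] at h3
      have h4 := norm_sub_le_norm_sub_add_norm_sub (D (γ t)) (D (γ 0)) c
      rw [mem_ball_iff_norm]
      linarith [h'.nonneg]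
    refine (T2Space.isSeparatedMap D).eqOn_of_comp_eqOn hD.isLocallyInjective isPreconnected_Icc hγ
      (hs.comp (hD.continuous.comp_continuousOn hγ) hin) (fun t ht => ?_)
      (left_mem_Icc.2 zero_le_one) hps (right_mem_Icc.2 zero_le_one)
    exact (hDs _ (hin t ht)).symm

theorem eq_section_of_flatEDist_lt [T2Space Y] (hD : IsLocalHomeomorph D) {s : ℂ → Y} {c : ℂ}
    {r δ : ℝ} (hs : ContinuousOn s (Metric.ball c r)) (hDs : ∀ z ∈ Metric.ball c r, D (s z) = z)
    {p q : Y} (hd : hD.translationAtlas.flatEDist p q < ENNReal.ofReal δ)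
    (hp : ‖D p - c‖ + δ ≤ r) (hps : p = s (D p)) : q = s (D q) := by
  simp only [TranslationAtlas.flatEDist, iInf_lt_iff] at hd
  obtain ⟨ℓ, hj, hl⟩ := hd
  rw [ENNReal.ofReal_lt_ofReal_iff'] at hl
  exact hD.eq_section_of_piecewiseJoined hs hDs hj (by linarith [hl.1]) hps

/-- The section lifts straight segments, and no path is shorter than its projected displacement. -/
theorem flatEDist_section (hD : IsLocalHomeomorph D) {s : ℂ → Y} {c : ℂ}
    {r : ℝ} (hs : ContinuousOn s (Metric.ball c r)) (hDs : ∀ z ∈ Metric.ball c r, D (s z) = z)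
    {z z' : ℂ} (hz : z ∈ Metric.ball c r) (hz' : z' ∈ Metric.ball c r) :
    hD.translationAtlas.flatEDist (s z) (s z') = ENNReal.ofReal ‖z' - z‖ := by
  refine le_antisymm ?_ ?_
  · have hin : ∀ t ∈ Icc (0 : ℝ) 1, z + t * (z' - z) ∈ Metric.ball c r := fun t ht => by
      have := (convex_ball c r).add_smul_sub_mem hz hz' ht
      simpa using this
    have hc : Continuous fun t : ℝ => z + t * (z' - z) := by fun_prop
    have hj : hD.translationAtlas.C1Joined (s z) (s z') ‖z' - z‖ := by
      refine hD.c1Joined_iff.2 ⟨fun t => s (z + t * (z' - z)), fun _ => z' - z,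
        hs.comp hc.continuousOn hin, continuousOn_const, by simp, by simp, fun t ht => ?_,
        by simp⟩
      have h1 : HasDerivAt (fun t : ℝ => z + t * (z' - z)) (z' - z) t := by
        simpa using ((Complex.ofRealCLM.hasDerivAt (x := t)).mul_const (z' - z)).const_add z
      exact h1.hasDerivWithinAt.congr (fun u hu => hDs _ (hin u hu)) (hDs _ (hin t ht))
    have hj' := TranslationAtlas.PiecewiseJoined.cons hj (.refl _)
    rw [add_zero] at hj'
    exact iInf₂_le _ hj'
  · have := hD.ofReal_norm_sub_le_flatEDist (s z) (s z')
    rwa [hDs z hz, hDs z' hz'] at this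

end IsLocalHomeomorph

/-! ## The completion -/

namespace TranslationAtlas

variable {Y : Type*} [TopologicalSpace Y] (𝒜 : TranslationAtlas Y)

theorem dist_flatSpace (p q : 𝒜.FlatSpace) :
    dist p q = (min (𝒜.flatEDist p.pt q.pt) 1).toReal := rfl

theorem dist_toCompletion (p q : Y) :
    dist (𝒜.toCompletion p) (𝒜.toCompletion q) = (min (𝒜.flatEDist p q) 1).toReal :=
  UniformSpace.Completion.dist_eq _ _

variable {𝒜}

theorem flatEDist_lt_of_toReal_lt {d : ℝ≥0∞} {δ : ℝ} (hδ : δ ≤ 1) (h : (min d 1).toReal < δ) :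
    d < ENNReal.ofReal δ := by
  have hne : min d 1 ≠ ∞ := ne_top_of_le_ne_top ENNReal.one_ne_top (min_le_right _ _)
  rw [← ENNReal.ofReal_lt_ofReal_iff (ENNReal.toReal_nonneg.trans_lt h),
    ENNReal.ofReal_toReal hne] at h
  rcases min_lt_iff.1 h with h | h
  · exact h
  · rw [ENNReal.one_lt_ofReal] at h
    linarith

/-- Lipschitz bounds survive the cut-off at `1` only for constants `K ≥ 1`. -/
theorem min_toReal_le_mul {d d' : ℝ≥0∞} {K : ℝ} (hK : 1 ≤ K) (h : d ≤ ENNReal.ofReal K * d') :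
    (min d 1).toReal ≤ K * (min d' 1).toReal := by
  have hne : min d' 1 ≠ ∞ := ne_top_of_le_ne_top ENNReal.one_ne_top (min_le_right _ _)
  rw [← ENNReal.toReal_ofReal (zero_le_one.trans hK), ← ENNReal.toReal_mul]
  refine ENNReal.toReal_mono (ENNReal.mul_ne_top ENNReal.ofReal_ne_top hne) ?_
  rw [mul_min, mul_one]
  exact min_le_min h (ENNReal.one_le_ofReal.2 hK)

theorem denseRange_toCompletion : DenseRange 𝒜.toCompletion := by
  have h : range 𝒜.toCompletion = range ((↑) : 𝒜.FlatSpace → 𝒜.MetricCompletion) := by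
    ext x
    exact ⟨fun ⟨p, hp⟩ => ⟨⟨p⟩, hp⟩, fun ⟨p, hp⟩ => ⟨p.pt, hp⟩⟩
  rw [DenseRange, h]
  exact UniformSpace.Completion.denseRange_coe

end TranslationAtlas

namespace IsLocalHomeomorph

variable {Y : Type*} [TopologicalSpace Y] {D : Y → ℂ} (hD : IsLocalHomeomorph D)

theorem uniformContinuous_flatSpace :
    UniformContinuous fun p : hD.translationAtlas.FlatSpace => D p.pt := by
  rw [Metric.uniformContinuous_iff]
  intro ε hε
  refine ⟨min ε 1, by positivity, fun p q hpq => ?_⟩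
  rw [TranslationAtlas.dist_flatSpace] at hpq
  have h1 := TranslationAtlas.flatEDist_lt_of_toReal_lt (min_le_right _ _) hpq
  have h2 := (hD.ofReal_norm_sub_le_flatEDist p.pt q.pt).trans_lt h1
  rw [ENNReal.ofReal_lt_ofReal_iff'] at h2
  rw [dist_comm, dist_eq_norm]
  exact h2.1.trans_le (min_le_left _ _)

/-- The extension of the local homeomorphism to the completion. -/
def completionProj : hD.translationAtlas.MetricCompletion → ℂ :=
  UniformSpace.Completion.extension fun p : hD.translationAtlas.FlatSpace => D p.pt

theorem continuous_completionProj : Continuous hD.completionProj :=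
  UniformSpace.Completion.continuous_extension

theorem completionProj_toCompletion (p : Y) :
    hD.completionProj (hD.translationAtlas.toCompletion p) = D p :=
  UniformSpace.Completion.extension_coe hD.uniformContinuous_flatSpace _

theorem continuousOn_toCompletion_section {s : ℂ → Y} {c : ℂ} {r : ℝ}
    (hs : ContinuousOn s (Metric.ball c r)) (hDs : ∀ z ∈ Metric.ball c r, D (s z) = z) :
    ContinuousOn (fun z => hD.translationAtlas.toCompletion (s z)) (Metric.ball c r) := by
  refine LipschitzOnWith.continuousOn (K := 1) (LipschitzOnWith.of_dist_le_mul fun z hz z' hz' => ?_)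
  rw [TranslationAtlas.dist_toCompletion, hD.flatEDist_section hs hDs hz hz', NNReal.coe_one,
    one_mul, dist_comm, dist_eq_norm]
  refine (ENNReal.toReal_mono ENNReal.ofReal_ne_top (min_le_left _ _)).trans_eq ?_
  exact ENNReal.toReal_ofReal (norm_nonneg _)

end IsLocalHomeomorph

/-! ## Local isometries of complete spaces from dense subsets -/

/-- `y` and `y'` are the limits of `ι` and of `κ` along a common filter. -/
def LimitPair {P M N : Type*} [TopologicalSpace M] [TopologicalSpace N] (ι : P → M) (κ : P → N)
    (y : M) (y' : N) : Prop :=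
  ∃ l : Filter P, l.NeBot ∧ Tendsto ι l (𝓝 y) ∧ Tendsto κ l (𝓝 y')

namespace LimitPair

variable {P M N : Type*} [MetricSpace M] [MetricSpace N] {ι : P → M} {κ : P → N} {ρ : ℝ}

theorem symm {y : M} {y' : N} (h : LimitPair ι κ y y') : LimitPair κ ι y' y := by
  obtain ⟨l, hl, h1, h2⟩ := h
  exact ⟨l, hl, h2, h1⟩

/-- The condition `dist < ρ` is open, so it holds along the filters and equality of distances passes
to the limit. -/
theorem dist_eq (H : ∀ p q, dist (ι p) (ι q) < ρ → dist (ι p) (ι q) = dist (κ p) (κ q))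
    {y z : M} {y' z' : N} (hy : LimitPair ι κ y y') (hz : LimitPair ι κ z z') (h : dist y z < ρ) :
    dist y z = dist y' z' := by
  obtain ⟨l, hl, h1, h2⟩ := hy
  obtain ⟨l', hl', h1', h2'⟩ := hz
  have t1 : Tendsto (fun p : P × P => dist (ι p.1) (ι p.2)) (l ×ˢ l') (𝓝 (dist y z)) :=
    (h1.comp tendsto_fst).dist (h1'.comp tendsto_snd)
  have t2 : Tendsto (fun p : P × P => dist (κ p.1) (κ p.2)) (l ×ˢ l') (𝓝 (dist y' z')) :=
    (h2.comp tendsto_fst).dist (h2'.comp tendsto_snd)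
  refine tendsto_nhds_unique (t1.congr' ?_) t2
  filter_upwards [t1.eventually (gt_mem_nhds h)] with p hp
  exact H _ _ hp

theorem exists_of_mem_closure [CompleteSpace N] (hρ : 0 < ρ)
    (H : ∀ p q, dist (ι p) (ι q) < ρ → dist (ι p) (ι q) = dist (κ p) (κ q)) {y : M}
    (hy : y ∈ closure (range ι)) : ∃ y', LimitPair ι κ y y' := by
  have hne : (comap ι (𝓝 y)).NeBot := by
    rw [comap_neBot_iff]
    intro t ht
    obtain ⟨_, h, p, rfl⟩ := mem_closure_iff_nhds.1 hy t ht
    exact ⟨p, h⟩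
  have hc : Cauchy (map κ (comap ι (𝓝 y))) := by
    rw [Metric.cauchy_iff]
    refine ⟨hne.map _, fun ε hε => ⟨κ '' (ι ⁻¹' Metric.ball y (min ε ρ / 2)),
      image_mem_map (preimage_mem_comap (Metric.ball_mem_nhds _ (by positivity))), ?_⟩⟩
    rintro _ ⟨p, hp, rfl⟩ _ ⟨q, hq, rfl⟩
    have h1 : dist (ι p) (ι q) < min ε ρ := by
      have := dist_triangle_right (ι p) (ι q) y
      rw [mem_preimage, Metric.mem_ball] at hp hq
      linarith
    rw [← H p q (h1.trans_le (min_le_right _ _))]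
    exact h1.trans_le (min_le_left _ _)
  obtain ⟨y', hy'⟩ := CompleteSpace.complete hc
  exact ⟨y', _, hne, tendsto_comap, hy'⟩

/-- The two hypotheses on distances are symmetric. Limits therefore exist in both directions, and
the correspondences between small balls are mutually inverse isometries. Only a common
parametrisation of locally dense subsets is needed. -/
theorem locallyIsometricAt [CompleteSpace M] [CompleteSpace N] (hρ : 0 < ρ)
    (H : ∀ p q, dist (ι p) (ι q) < ρ → dist (ι p) (ι q) = dist (κ p) (κ q))
    (H' : ∀ p q, dist (κ p) (κ q) < ρ → dist (κ p) (κ q) = dist (ι p) (ι q))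
    {x : M} {a : N} (hxa : LimitPair ι κ x a) (hx : closure (range ι) ∈ 𝓝 x)
    (ha : closure (range κ) ∈ 𝓝 a) : LocallyIsometricAt x a := by
  obtain ⟨r₁, hr₁, hx⟩ := Metric.mem_nhds_iff.1 hx
  obtain ⟨r₂, hr₂, ha⟩ := Metric.mem_nhds_iff.1 ha
  obtain ⟨R, hR, hR₁, hR₂, hR₃⟩ : ∃ R > 0, R ≤ r₁ ∧ R ≤ r₂ ∧ 2 * R ≤ ρ :=
    ⟨min (min r₁ r₂) (ρ / 2), by positivity, (min_le_left _ _).trans (min_le_left _ _),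
      (min_le_left _ _).trans (min_le_right _ _), by linarith [min_le_right (min r₁ r₂) (ρ / 2)]⟩
  have hF : ∀ y : Metric.ball x R, ∃ y' : Metric.ball a R, LimitPair ι κ y.1 y'.1 := by
    intro y
    have hy := Metric.mem_ball.1 y.2
    obtain ⟨y', h⟩ := exists_of_mem_closure hρ H (hx (Metric.ball_subset_ball hR₁ y.2))
    refine ⟨⟨y', ?_⟩, h⟩
    rw [Metric.mem_ball, ← h.dist_eq H hxa (by linarith)]
    exact hy
  have hG : ∀ y' : Metric.ball a R, ∃ y : Metric.ball x R, LimitPair ι κ y.1 y'.1 := by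
    intro y
    have hy := Metric.mem_ball.1 y.2
    obtain ⟨y', h⟩ := exists_of_mem_closure hρ H' (ha (Metric.ball_subset_ball hR₂ y.2))
    refine ⟨⟨y', ?_⟩, h.symm⟩
    rw [Metric.mem_ball, ← h.dist_eq H' hxa.symm (by linarith)]
    exact hy
  choose F hF using hF
  choose G hG using hG
  refine ⟨_, _, IsometryEquiv.mk' F G (fun y => ?_) (Isometry.of_dist_eq fun y z => ?_),
    Metric.mem_ball_self hR, Metric.isOpen_ball, Metric.isOpen_ball, ?_⟩
  · have h := (hF (G y)).dist_eq H (hG y) (by rw [dist_self]; exact hρ)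
    rw [dist_self] at h
    exact Subtype.ext (dist_eq_zero.1 h.symm)
  · refine ((hF y).dist_eq H (hF z) ?_).symm
    have h1 := Metric.mem_ball.1 y.2
    have h2 := Metric.mem_ball.1 z.2
    have := dist_triangle_right y.1 z.1 x
    linarith
  · have h := (hF ⟨x, Metric.mem_ball_self hR⟩).dist_eq H hxa (by rw [dist_self]; exact hρ)
    rw [dist_self] at h
    exact dist_eq_zero.1 h.symm

end LimitPair

/-! ## Local structure of the curves `w ^ m = f z` -/

/-- Near `a` the quotient `u z / u a` is close to `1`, where the principal power is continuous; a
root of `u a` restores the scale. -/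
theorem exists_local_root {u : ℂ → ℂ} (hu : Continuous u) {a : ℂ} (ha : u a ≠ 0) {m : ℕ}
    (hm : m ≠ 0) : ∃ r : ℝ, 0 < r ∧ r ≤ 1 ∧ ∃ μ : ℂ → ℂ, ContinuousOn μ (Metric.ball a r) ∧
      ∀ z ∈ Metric.ball a r, μ z ^ m = u z ∧ μ z ≠ 0 := by
  obtain ⟨c, hc⟩ := IsAlgClosed.exists_pow_nat_eq (u a) (Nat.pos_of_ne_zero hm)
  have hopen : {z | u z / u a ∈ Complex.slitPlane} ∈ 𝓝 a :=
    (Complex.isOpen_slitPlane.preimage (hu.div_const _)).mem_nhds (by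
      simp [ha, Complex.one_mem_slitPlane])
  obtain ⟨r, hr, hsub⟩ := Metric.mem_nhds_iff.1 hopen
  refine ⟨min r 1, by positivity, min_le_right _ _, fun z => c * (u z / u a) ^ (m⁻¹ : ℂ),
    fun z hz => ?_, fun z hz => ?_⟩
  · have hz' := hsub (Metric.ball_subset_ball (min_le_left _ _) hz)
    exact (continuousAt_const.mul
      ((hu.div_const _).continuousAt.cpow continuousAt_const hz')).continuousWithinAt
  · have hz' := hsub (Metric.ball_subset_ball (min_le_left _ _) hz)
    have h1 : (c * (u z / u a) ^ (m⁻¹ : ℂ)) ^ m = u z := by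
      rw [mul_pow, Complex.cpow_nat_inv_pow _ hm, hc, mul_div_cancel₀ _ ha]
    refine ⟨h1, fun h0 => ?_⟩
    beta_reduce at h0
    rw [h0, zero_pow hm] at h1
    exact Complex.slitPlane_ne_zero hz' (by rw [← h1, zero_div])

theorem exists_continuousOn_codRestrict {A B : Type*} [TopologicalSpace A] [TopologicalSpace B]
    {R : Set B} (b : R) {S : Set A} {F : A → B} (hF : ContinuousOn F S) (hR : ∀ x ∈ S, F x ∈ R) :
    ∃ G : A → R, ContinuousOn G S ∧ ∀ x ∈ S, (G x : B) = F x := by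
  classical
  refine ⟨fun x => if h : F x ∈ R then ⟨F x, h⟩ else b, ?_, fun x hx => by simp [hR x hx]⟩
  rw [Topology.IsInducing.subtypeVal.continuousOn_iff]
  exact hF.congr fun x hx => by simp [hR x hx]

section Curve

variable {f : ℂ → ℂ} {m : ℕ}

theorem regularPart_pow_eq (p : regularPart f m) : p.1.2 ^ m = f (curveProj f m p) := p.2.1

theorem regularPart_snd_ne_zero (p : regularPart f m) : p.1.2 ≠ 0 := p.2.2

theorem apply_curveProj_ne_zero (p : regularPart f m) : f (curveProj f m p) ≠ 0 := by
  rw [← regularPart_pow_eq p]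
  exact pow_ne_zero _ (regularPart_snd_ne_zero p)

theorem exists_regularPart (hm : m ≠ 0) {z : ℂ} (hz : f z ≠ 0) :
    ∃ p : regularPart f m, curveProj f m p = z := by
  obtain ⟨w, hw⟩ := IsAlgClosed.exists_pow_nat_eq (f z) (Nat.pos_of_ne_zero hm)
  refine ⟨⟨(z, w), hw, fun h0 => hz ?_⟩, rfl⟩
  have h0' : w = 0 := h0
  rw [← hw, h0', zero_pow hm]

theorem continuous_curveProj : Continuous (curveProj f m) :=
  continuous_fst.comp continuous_subtype_val

/-- One radius serves all sheets: the sections differ by a constant factor, chosen to pass through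
`p`. -/
theorem exists_section (hf : Continuous f) (hm : m ≠ 0) {a : ℂ} (ha : f a ≠ 0) :
    ∃ r : ℝ, 0 < r ∧ r ≤ 1 ∧ ∀ p : regularPart f m, curveProj f m p ∈ Metric.ball a r →
      ∃ s : ℂ → regularPart f m, ContinuousOn s (Metric.ball a r) ∧
        (∀ z ∈ Metric.ball a r, curveProj f m (s z) = z) ∧ s (curveProj f m p) = p := by
  obtain ⟨r, hr, hr1, μ, hμ, hμf⟩ := exists_local_root hf ha hm
  refine ⟨r, hr, hr1, fun p hp => ?_⟩
  have hp0 := (hμf _ hp).2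
  obtain ⟨s, hs, hs'⟩ := exists_continuousOn_codRestrict (R := regularPart f m) p
    (F := fun z => (z, p.1.2 / μ (curveProj f m p) * μ z))
    (continuousOn_id.prodMk (continuousOn_const.mul hμ)) fun z hz => by
      refine ⟨?_, mul_ne_zero (div_ne_zero (regularPart_snd_ne_zero p) hp0) (hμf z hz).2⟩
      change (p.1.2 / μ (curveProj f m p) * μ z) ^ m = f z
      rw [mul_pow, div_pow, regularPart_pow_eq, (hμf _ hp).1, (hμf z hz).1,
        div_self (apply_curveProj_ne_zero p), one_mul]
  refine ⟨s, hs, fun z hz => by rw [curveProj, hs' z hz], Subtype.ext ?_⟩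
  rw [hs' _ hp, div_mul_cancel₀ _ hp0]
  rfl

theorem isFlatPoint_toCompletion (hf : Continuous f) (hm : m ≠ 0) (p : regularPart f m) :
    (curveAtlas f hf m hm).IsFlatPoint ((curveAtlas f hf m hm).toCompletion p) := by
  set D := curveProj f m with hDdef
  have hD : IsLocalHomeomorph D := isLocalHomeomorph_curveProj hf hm
  change hD.translationAtlas.IsFlatPoint (hD.translationAtlas.toCompletion p)
  obtain ⟨r, hr, hr1, hsec⟩ := exists_section hf hm (apply_curveProj_ne_zero p)
  obtain ⟨s, hs, hDs, hsp⟩ := hsec p (Metric.mem_ball_self hr)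
  -- In the half disc all distances stay below `r ≤ 1`, where the cut-off is inactive.
  have hsub : Metric.ball (D p) (r / 2) ⊆ Metric.ball (D p) r :=
    Metric.ball_subset_ball (by linarith)
  have hdist : ∀ z z' : Metric.ball (D p) (r / 2),
      dist (hD.translationAtlas.toCompletion (s z)) (hD.translationAtlas.toCompletion (s z')) =
        dist (z : ℂ) z' := by
    intro z z'
    have h1 := Metric.mem_ball.1 z.2
    have h2 := Metric.mem_ball.1 z'.2
    have h3 := dist_triangle_right z.1 z'.1 (D p)
    rw [TranslationAtlas.dist_toCompletion, hD.flatEDist_section hs hDs (hsub z.2) (hsub z'.2),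
      ← dist_eq_norm, dist_comm z'.1, min_eq_left, ENNReal.toReal_ofReal dist_nonneg]
    rw [ENNReal.ofReal_le_one]
    linarith
  refine ⟨D p, LimitPair.locallyIsometricAt
    (ι := fun z : Metric.ball (D p) (r / 2) => hD.translationAtlas.toCompletion (s z))
    (κ := fun z => (z : ℂ)) one_pos (fun z z' _ => hdist z z') (fun z z' _ => (hdist z z').symm)
    ?_ ?_ ?_⟩
  · refine ⟨pure ⟨D p, Metric.mem_ball_self (by positivity)⟩, inferInstance, ?_, ?_⟩
    · rw [tendsto_pure_left]
      intro t ht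
      change hD.translationAtlas.toCompletion (s (D p)) ∈ t
      rw [hsp]
      exact mem_of_mem_nhds ht
    · rw [tendsto_pure_left]
      exact fun t ht => mem_of_mem_nhds ht
  · have hb : Metric.ball (hD.translationAtlas.toCompletion p) (r / 2) ∈
        𝓝 (hD.translationAtlas.toCompletion p) := Metric.ball_mem_nhds _ (by positivity)
    refine mem_of_superset hb ?_
    refine (TranslationAtlas.denseRange_toCompletion.open_subset_closure_inter
      Metric.isOpen_ball).trans (closure_mono ?_)
    rintro _ ⟨hq, q, rfl⟩
    rw [Metric.mem_ball, dist_comm, TranslationAtlas.dist_toCompletion] at hq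
    have hlt := TranslationAtlas.flatEDist_lt_of_toReal_lt (by linarith) hq
    have h0 : ‖D p - D p‖ + r / 2 ≤ r := by
      rw [sub_self, norm_zero]
      linarith
    have h1 := hD.eq_section_of_flatEDist_lt hs hDs hlt h0 hsp.symm
    have h2 := (hD.ofReal_norm_sub_le_flatEDist p q).trans_lt hlt
    rw [ENNReal.ofReal_lt_ofReal_iff'] at h2
    exact ⟨⟨D q, by rw [mem_ball_iff_norm]; exact h2.1⟩,
      congrArg hD.translationAtlas.toCompletion h1.symm⟩
  · rw [Subtype.range_coe]
    exact mem_of_superset (Metric.ball_mem_nhds _ (by positivity)) subset_closure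

/-- The points that the completion adds to the regular part lie over the zeros of `f`. -/
theorem apply_completionProj_eq_zero (hf : Continuous f) (hm : m ≠ 0)
    {x : (curveAtlas f hf m hm).MetricCompletion} (hx : x ∈ (curveAtlas f hf m hm).sing) :
    f ((isLocalHomeomorph_curveProj hf hm).completionProj x) = 0 := by
  set D := curveProj f m with hDdef
  have hD : IsLocalHomeomorph D := isLocalHomeomorph_curveProj hf hm
  change hD.translationAtlas.MetricCompletion at x
  change x ∈ hD.translationAtlas.sing at hx
  by_contra h0
  change f (hD.completionProj x) ≠ 0 at h0
  obtain ⟨r, hr, hr1, hsec⟩ := exists_section hf hm h0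
  set a := hD.completionProj x with ha
  -- A nearby regular point `q` selects a sheet `s`. Regular points within `r / 4` of `x` are within
  -- `r / 2` of `q`, hence on that sheet, and converge to `s a`. So `x` would be regular.
  have hU : Metric.ball x (r / 4) ∩ hD.completionProj ⁻¹' Metric.ball a (r / 4) ∈ 𝓝 x :=
    inter_mem (Metric.ball_mem_nhds _ (by positivity))
      (hD.continuous_completionProj.continuousAt.preimage_mem_nhds
        (Metric.ball_mem_nhds _ (by positivity)))
  obtain ⟨_, ⟨hq1, hq2⟩, q, rfl⟩ :=
    mem_closure_iff_nhds.1 (TranslationAtlas.denseRange_toCompletion x) _ hU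
  rw [mem_preimage, hD.completionProj_toCompletion] at hq2
  obtain ⟨s, hs, hDs, hsq⟩ := hsec q (Metric.ball_subset_ball (by linarith) hq2)
  have hne : (comap hD.translationAtlas.toCompletion (𝓝 x)).NeBot := by
    rw [comap_neBot_iff]
    intro t ht
    obtain ⟨_, h, p, rfl⟩ :=
      mem_closure_iff_nhds.1 (TranslationAtlas.denseRange_toCompletion x) t ht
    exact ⟨p, h⟩
  have ht1 : Tendsto D (comap hD.translationAtlas.toCompletion (𝓝 x)) (𝓝 a) := by
    have := (hD.continuous_completionProj.tendsto x).comp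
      (tendsto_comap (f := hD.translationAtlas.toCompletion) (x := 𝓝 x))
    refine this.congr fun p => ?_
    exact hD.completionProj_toCompletion p
  have ht2 := ((hD.continuousOn_toCompletion_section hs hDs).continuousAt
    (Metric.ball_mem_nhds a hr)).tendsto.comp ht1
  have hev : ∀ᶠ p in comap hD.translationAtlas.toCompletion (𝓝 x),
      hD.translationAtlas.toCompletion p = hD.translationAtlas.toCompletion (s (D p)) := by
    filter_upwards [preimage_mem_comap (Metric.ball_mem_nhds x (show 0 < r / 4 by positivity))]
      with p hp
    have h1 : dist (hD.translationAtlas.toCompletion q) (hD.translationAtlas.toCompletion p)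
        < r / 2 := by
      have := dist_triangle_right (hD.translationAtlas.toCompletion q)
        (hD.translationAtlas.toCompletion p) x
      rw [mem_preimage, Metric.mem_ball] at hp
      rw [Metric.mem_ball] at hq1
      linarith
    rw [TranslationAtlas.dist_toCompletion] at h1
    have hlt := TranslationAtlas.flatEDist_lt_of_toReal_lt (by linarith) h1
    rw [mem_ball_iff_norm] at hq2
    exact congrArg _ (hD.eq_section_of_flatEDist_lt hs hDs hlt (by linarith) hsq.symm)
  have heq := tendsto_nhds_unique (tendsto_comap.congr' hev) ht2
  exact hx ⟨s a, heq.symm⟩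

/-- Dividing `w` by `μ z` turns the equation into `w ^ m = z - a`. This change of variables covers a
translation, hence preserves lengths of paths, and it extends to the completions by density. -/
theorem isConePoint_of_completionProj_eq (hf : Continuous f) (hm : m ≠ 0) {a : ℂ} {r : ℝ}
    (hr : 0 < r) (hr1 : r ≤ 1) {μ : ℂ → ℂ} (hμ : ContinuousOn μ (Metric.ball a r))
    (hμ0 : ∀ z ∈ Metric.ball a r, f z = (z - a) * μ z ^ m ∧ μ z ≠ 0)
    {x : (curveAtlas f hf m hm).MetricCompletion}
    (hx : (isLocalHomeomorph_curveProj hf hm).completionProj x = a) :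
    (curveAtlas f hf m hm).IsConePoint m x := by
  refine ⟨hm, ?_⟩
  set D := curveProj f m with hDdef
  have hD : IsLocalHomeomorph D := isLocalHomeomorph_curveProj hf hm
  set E := curveProj id m with hEdef
  have hE : IsLocalHomeomorph E := isLocalHomeomorph_curveProj continuous_id hm
  change hD.translationAtlas.MetricCompletion at x
  change hD.completionProj x = a at hx
  change ∃ b ∈ hE.translationAtlas.sing, LocallyIsometricAt x b
  have hU : hD.completionProj ⁻¹' Metric.ball a (r / 4) ∈ 𝓝 x :=
    hD.continuous_completionProj.continuousAt.preimage_mem_nhds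
        (by rw [hx]; exact Metric.ball_mem_nhds _ (by positivity))
  obtain ⟨_, hp0, p0, rfl⟩ :=
    mem_closure_iff_nhds.1 (TranslationAtlas.denseRange_toCompletion x) _ hU
  obtain ⟨q0, -⟩ := exists_regularPart (f := id) hm (one_ne_zero (α := ℂ))
  obtain ⟨Ψ, hΨ, hΨ'⟩ := exists_continuousOn_codRestrict (R := regularPart id m) q0
    (S := {p : regularPart f m | ‖D p - a‖ < r}) (F := fun p => (D p - a, p.1.2 / μ (D p)))
    (by
      refine (hD.continuous.continuousOn.sub continuousOn_const).prodMk (ContinuousOn.div ?_ ?_ ?_)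
      · exact (continuous_snd.comp continuous_subtype_val).continuousOn
      · exact hμ.comp hD.continuous.continuousOn fun p hp => mem_ball_iff_norm.2 hp
      · exact fun p hp => (hμ0 _ (mem_ball_iff_norm.2 hp)).2)
    fun p hp => by
      obtain ⟨h1, h2⟩ := hμ0 _ (mem_ball_iff_norm.2 hp)
      refine ⟨?_, div_ne_zero (regularPart_snd_ne_zero p) h2⟩
      change (p.1.2 / μ (D p)) ^ m = D p - a
      rw [div_pow, regularPart_pow_eq, h1, mul_div_cancel_right₀ _ (pow_ne_zero _ h2)]
  have hball : ∀ q : regularPart id m, ‖E q - 0‖ < r → E q + a ∈ Metric.ball a r := fun q hq => by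
    rw [mem_ball_iff_norm, add_sub_cancel_right, ← sub_zero (E q)]
    exact hq
  obtain ⟨Φ, hΦ, hΦ'⟩ := exists_continuousOn_codRestrict (R := regularPart f m) p0
    (S := {q : regularPart id m | ‖E q - 0‖ < r}) (F := fun q => (E q + a, q.1.2 * μ (E q + a)))
    (by
      refine (hE.continuous.continuousOn.add continuousOn_const).prodMk (ContinuousOn.mul ?_ ?_)
      · exact (continuous_snd.comp continuous_subtype_val).continuousOn
      · exact hμ.comp (hE.continuous.continuousOn.add continuousOn_const) hball)
    fun q hq => by
      obtain ⟨h1, h2⟩ := hμ0 _ (hball q hq)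
      refine ⟨?_, mul_ne_zero (regularPart_snd_ne_zero q) h2⟩
      change (q.1.2 * μ (E q + a)) ^ m = f (E q + a)
      rw [mul_pow, regularPart_pow_eq, h1, add_sub_cancel_right]
      rfl
  have hEΨ : ∀ p, ‖D p - a‖ < r → E (Ψ p) = D p + -a := fun p hp => by
    rw [hEdef, curveProj, hΨ' p hp, sub_eq_add_neg]
  have hDΦ : ∀ q, ‖E q - 0‖ < r → D (Φ q) = E q + a := fun q hq => by
    rw [hDdef, curveProj, hΦ' q hq]
  have hEΨr : ∀ p, ‖D p - a‖ < r → ‖E (Ψ p) - 0‖ = ‖D p - a‖ := fun p hp => by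
    rw [hEΨ p hp, sub_zero, sub_eq_add_neg]
  have hDΦr : ∀ q, ‖E q - 0‖ < r → ‖D (Φ q) - a‖ = ‖E q - 0‖ := fun q hq => by
    rw [hDΦ q hq, sub_zero, add_sub_cancel_right]
  have hΦΨ : ∀ p, ‖D p - a‖ < r → Φ (Ψ p) = p := fun p hp => by
    have h1 : ‖E (Ψ p) - 0‖ < r := by rwa [hEΨr p hp]
    have h2 : E (Ψ p) + a = D p := by rw [hEΨ p hp]; ring
    refine Subtype.ext ?_
    rw [hΦ' _ h1, h2, hΨ' p hp]
    refine Prod.ext rfl ?_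
    exact div_mul_cancel₀ _ (hμ0 _ (mem_ball_iff_norm.2 hp)).2
  have hΨΦ : ∀ q, ‖E q - 0‖ < r → Ψ (Φ q) = q := fun q hq => by
    have h1 : ‖D (Φ q) - a‖ < r := by rwa [hDΦr q hq]
    refine Subtype.ext ?_
    rw [hΨ' _ h1, hDΦ q hq, hΦ' q hq]
    refine Prod.ext (add_sub_cancel_right _ _) ?_
    exact mul_div_cancel_right₀ _ (hμ0 _ (hball q hq)).2
  -- A path of length below `r / 2` starting over the disc of radius `r / 4` stays over the disc of
  -- radius `r`, where `Ψ` and `Φ` are mutually inverse.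
  have hle : ∀ p q, ‖D p - a‖ < r / 4 → hD.translationAtlas.flatEDist p q < ENNReal.ofReal (r / 2) →
      hE.translationAtlas.flatEDist (Ψ p) (Ψ q) ≤ hD.translationAtlas.flatEDist p q :=
    fun p q hp h => hD.flatEDist_map_le_of_translation hE hΨ hEΨ (by linarith) h
  have hle' : ∀ p q, ‖D p - a‖ < r / 4 → ‖D q - a‖ < r / 4 →
      hE.translationAtlas.flatEDist (Ψ p) (Ψ q) < ENNReal.ofReal (r / 2) →
      hD.translationAtlas.flatEDist p q ≤ hE.translationAtlas.flatEDist (Ψ p) (Ψ q) := by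
    intro p q hp hq h
    have h1 := hE.flatEDist_map_le_of_translation hD hΦ hDΦ
      (by rw [hEΨr p (by linarith)]; linarith) h
    rwa [hΦΨ p (by linarith), hΦΨ q (by linarith)] at h1
  let P := {p : regularPart f m // ‖D p - a‖ < r / 4}
  let ι : P → hD.translationAtlas.MetricCompletion := fun p => hD.translationAtlas.toCompletion p.1
  let κ : P → hE.translationAtlas.MetricCompletion :=
    fun p => hE.translationAtlas.toCompletion (Ψ p.1)
  have H : ∀ p q, dist (ι p) (ι q) < r / 2 → dist (ι p) (ι q) = dist (κ p) (κ q) := by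
    intro p q h
    simp only [ι, κ, TranslationAtlas.dist_toCompletion] at h ⊢
    have h1 := TranslationAtlas.flatEDist_lt_of_toReal_lt (by linarith) h
    have h2 := hle _ _ p.2 h1
    rw [le_antisymm h2 (hle' _ _ p.2 q.2 (h2.trans_lt h1))]
  have H' : ∀ p q, dist (κ p) (κ q) < r / 2 → dist (κ p) (κ q) = dist (ι p) (ι q) := by
    intro p q h
    simp only [ι, κ, TranslationAtlas.dist_toCompletion] at h ⊢
    have h1 := TranslationAtlas.flatEDist_lt_of_toReal_lt (by linarith) h
    have h2 := hle' _ _ p.2 q.2 h1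
    rw [le_antisymm h2 (hle _ _ p.2 (h2.trans_lt h1))]
  have hι : closure (range ι) ∈ 𝓝 x := by
    refine mem_of_superset hU ((TranslationAtlas.denseRange_toCompletion.open_subset_closure_inter
      (Metric.isOpen_ball.preimage hD.continuous_completionProj)).trans (closure_mono ?_))
    rintro _ ⟨hq, q, rfl⟩
    rw [mem_preimage, hD.completionProj_toCompletion, mem_ball_iff_norm] at hq
    exact ⟨⟨q, hq⟩, rfl⟩
  obtain ⟨b, hxb⟩ := LimitPair.exists_of_mem_closure (by positivity) H (mem_of_mem_nhds hι)
  -- This shows that `b` is singular in the model: regular points do not project to `0`.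
  have hb : hE.completionProj b = 0 := by
    obtain ⟨l, hl, h1, h2⟩ := hxb
    have t1 := (hD.continuous_completionProj.tendsto x).comp h1
    have t2 := (hE.continuous_completionProj.tendsto b).comp h2
    have t3 := (t1.add_const (-a)).congr (f₂ := hE.completionProj ∘ κ) fun p => by
      simp only [Function.comp_apply, ι, κ, IsLocalHomeomorph.completionProj_toCompletion]
      exact (hEΨ p.1 (by linarith [p.2])).symm
    rw [tendsto_nhds_unique t2 t3, hx, add_neg_cancel]
  refine ⟨b, ?_, LimitPair.locallyIsometricAt (by positivity) H H' hxb hι ?_⟩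
  · rintro ⟨q, rfl⟩
    rw [hE.completionProj_toCompletion] at hb
    exact apply_curveProj_ne_zero q hb
  · have hV : hE.completionProj ⁻¹' Metric.ball 0 (r / 4) ∈ 𝓝 b :=
      hE.continuous_completionProj.continuousAt.preimage_mem_nhds
        (by rw [hb]; exact Metric.ball_mem_nhds _ (by positivity))
    refine mem_of_superset hV ((TranslationAtlas.denseRange_toCompletion.open_subset_closure_inter
      (Metric.isOpen_ball.preimage hE.continuous_completionProj)).trans (closure_mono ?_))
    rintro _ ⟨hq, q, rfl⟩
    rw [mem_preimage, hE.completionProj_toCompletion, mem_ball_iff_norm] at hq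
    have hq' : ‖E q - 0‖ < r := by linarith
    exact ⟨⟨Φ q, by rwa [hDΦr q hq']⟩, congrArg hE.translationAtlas.toCompletion (hΨΦ q hq')⟩

/-! ## Connectedness -/

/-- The part of the curve over a small punctured disc about a simple zero is contained in a
connected set. -/
theorem exists_isPreconnected_over_punctured_ball (hm : m ≠ 0) {a : ℂ} {r : ℝ}
    {μ : ℂ → ℂ} (hμ : ContinuousOn μ (Metric.ball a r))
    (hμ0 : ∀ z ∈ Metric.ball a r, f z = (z - a) * μ z ^ m ∧ μ z ≠ 0) (p₀ : regularPart f m) :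
    ∃ V : Set (regularPart f m), IsPreconnected V ∧ ∀ p, curveProj f m p ∈ Metric.ball a r → p ∈ V := by
  have hm' : (m : ℂ) ≠ 0 := Nat.cast_ne_zero.2 hm
  have hb : ∀ s ∈ {s : ℂ | s.re < Real.log r}, 0 < r → a + Complex.exp s ∈ Metric.ball a r := by
    intro s hs hr
    rw [mem_ball_iff_norm, add_sub_cancel_left, Complex.norm_exp]
    exact (Real.lt_log_iff_exp_lt hr).1 hs
  rcases le_or_gt r 0 with hr | hr
  · exact ⟨∅, isPreconnected_empty, fun p hp => by simp [Metric.ball_eq_empty.2 hr] at hp⟩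
  -- The half-plane uniformises the punctured disc through `a + exp s`, with `exp (s / m)` as the
  -- root of `z - a`.
  obtain ⟨G, hG, hG'⟩ := exists_continuousOn_codRestrict (R := regularPart f m) p₀
    (S := {s : ℂ | s.re < Real.log r})
    (F := fun s => (a + Complex.exp s, Complex.exp (s / m) * μ (a + Complex.exp s)))
    (by
      refine ContinuousOn.prodMk (by fun_prop) (ContinuousOn.mul (by fun_prop) ?_)
      exact hμ.comp (by fun_prop) fun s hs => hb s hs hr)
    fun s hs => by
      obtain ⟨h1, h2⟩ := hμ0 _ (hb s hs hr)
      refine ⟨?_, mul_ne_zero (Complex.exp_ne_zero _) h2⟩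
      change (Complex.exp (s / m) * μ (a + Complex.exp s)) ^ m = f (a + Complex.exp s)
      rw [mul_pow, ← Complex.exp_nat_mul, mul_div_cancel₀ _ hm', h1, add_sub_cancel_left]
  refine ⟨G '' {s : ℂ | s.re < Real.log r},
    (convex_halfSpace_re_lt _).isPreconnected.image _ hG, fun p hp => ?_⟩
  obtain ⟨h1, h2⟩ := hμ0 _ hp
  have hw : p.1.2 / μ (curveProj f m p) ≠ 0 := div_ne_zero (regularPart_snd_ne_zero p) h2
  -- Taking `s` as `m` times a logarithm of `w / μ z` hits the right sheet, since then `exp (s / m)`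
  -- is exactly `w / μ z`.
  have h3 : Complex.exp (m * Complex.log (p.1.2 / μ (curveProj f m p))) = curveProj f m p - a := by
    rw [Complex.exp_nat_mul, Complex.exp_log hw, div_pow, regularPart_pow_eq, h1,
      mul_div_cancel_right₀ _ (pow_ne_zero _ h2)]
  have h4 : m * Complex.log (p.1.2 / μ (curveProj f m p)) ∈ {s : ℂ | s.re < Real.log r} := by
    rw [mem_ofPred_eq, Real.lt_log_iff_exp_lt hr, ← Complex.norm_exp, h3]
    exact mem_ball_iff_norm.1 hp
  refine ⟨_, h4, Subtype.ext ?_⟩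
  rw [hG' _ h4, h3, mul_div_cancel_left₀ _ hm', Complex.exp_log hw, add_sub_cancel,
    div_mul_cancel₀ _ h2]
  rfl

/-- Every nonempty clopen set meets every fibre, and all fibres over one small punctured disc lie in
a single connected set, so two disjoint nonempty clopen sets cannot exist. -/
theorem preconnectedSpace_regularPart (hf : Continuous f) (hm : m ≠ 0)
    (hZ : {z | f z = 0}.Countable) {a : ℂ} {r : ℝ} (hr : 0 < r)
    {μ : ℂ → ℂ} (hμ : ContinuousOn μ (Metric.ball a r))
    (hμ0 : ∀ z ∈ Metric.ball a r, f z = (z - a) * μ z ^ m ∧ μ z ≠ 0) :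
    PreconnectedSpace (regularPart f m) := by
  have hD : IsLocalHomeomorph (curveProj f m) := isLocalHomeomorph_curveProj hf hm
  have hconn : IsPreconnected {z | f z = 0}ᶜ :=
    (hZ.isConnected_compl_of_one_lt_rank (by simp)).isPreconnected
  have hmem : ∀ p : regularPart f m, curveProj f m p ∈ {z | f z = 0}ᶜ := apply_curveProj_ne_zero
  -- a nonempty clopen set meets every fibre
  have key : ∀ C : Set (regularPart f m), IsClopen C → C.Nonempty →
      ∀ z, f z ≠ 0 → ∃ p ∈ C, curveProj f m p = z := by
    intro C hC hne z hz
    by_contra hcon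
    -- The base points whose fibre misses `C` form an open set because a sheet over a disc that
    -- meets `C` lies in `C`.
    have hV : IsOpen {z | f z ≠ 0 ∧ ∀ p, curveProj f m p = z → p ∉ C} := by
      rw [isOpen_iff_mem_nhds]
      rintro y ⟨hy, hyC⟩
      obtain ⟨r, hr, -, hsec⟩ := exists_section hf hm hy
      refine mem_of_superset (Metric.ball_mem_nhds y hr) fun y' hy' => ?_
      have hy'0 : ∀ p, curveProj f m p = y' → p ∉ C := by
        rintro p rfl hp
        obtain ⟨s, hs, hDs, hsp⟩ := hsec p hy'
        have h1 : IsPreconnected (s '' Metric.ball y r) :=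
          (convex_ball y r).isPreconnected.image _ hs
        have h2 := h1.subset_isClopen hC ⟨p, ⟨_, hy', hsp⟩, hp⟩
        exact hyC (s y) (hDs y (Metric.mem_ball_self hr)) (h2 ⟨y, Metric.mem_ball_self hr, rfl⟩)
      refine ⟨fun h0 => ?_, hy'0⟩
      obtain ⟨p, hp⟩ := exists_regularPart (f := f) hm hy
      obtain ⟨s, hs, hDs, hsp⟩ := hsec p (by rw [hp]; exact Metric.mem_ball_self hr)
      have := apply_curveProj_ne_zero (s y')
      rw [hDs y' hy'] at this
      exact this h0
    obtain ⟨p, hp⟩ := hne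
    obtain ⟨y, hy0, ⟨q, hq, rfl⟩, -, h2⟩ := hconn _ _ (hD.isOpenMap C hC.isOpen) hV
      (fun y hy => by
        by_cases h : ∃ q ∈ C, curveProj f m q = y
        · exact Or.inl h
        · exact Or.inr ⟨hy, fun q hq hqC => h ⟨q, hqC, hq⟩⟩)
      ⟨_, hmem p, p, hp, rfl⟩ ⟨z, hz, hz, fun q hq hqC => hcon ⟨q, hqC, hq⟩⟩
    exact h2 q rfl hq
  refine preconnectedSpace_of_forall_constant fun g hg p q => ?_
  by_contra hpq
  obtain ⟨V, hV, hVa⟩ := exists_isPreconnected_over_punctured_ball hm hμ hμ0 p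
  obtain ⟨z, hz, hz0⟩ : ∃ z ∈ Metric.ball a r, f z ≠ 0 := by
    have h1 : a + (r / 2 : ℝ) ∈ Metric.ball a r := by
      rw [mem_ball_iff_norm, add_sub_cancel_left, Complex.norm_real, Real.norm_eq_abs,
        abs_of_pos (by positivity)]
      linarith
    refine ⟨_, h1, ?_⟩
    rw [(hμ0 _ h1).1, add_sub_cancel_left]
    exact mul_ne_zero (by exact_mod_cast (half_pos hr).ne') (pow_ne_zero _ (hμ0 _ h1).2)
  have hcl : ∀ b, IsClopen (g ⁻¹' {b}) := fun b => (isClopen_discrete {b}).preimage hg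
  obtain ⟨p', hp', hp'z⟩ := key _ (hcl (g p)) ⟨p, rfl⟩ z hz0
  obtain ⟨q', hq', hq'z⟩ := key _ (hcl (g q)) ⟨q, rfl⟩ z hz0
  have h1 := hV.subset_isClopen (hcl (g p)) ⟨p', hVa _ (by rwa [hp'z]), hp'⟩
  have h2 : g q' = g p := h1 (hVa q' (by rwa [hq'z]))
  have h3 : g q' = g q := hq'
  exact hpq (h2.symm.trans h3)

end Curve

/-! ## Infinite hyperelliptic curves are tame -/

namespace IsWeierstrassFunction

variable {f : ℂ → ℂ} {Z : ℕ → ℂ} {m : ℕ}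

theorem countable_zeros (h : IsWeierstrassFunction f Z) : {z | f z = 0}.Countable := by
  have : {z | f z = 0} = range Z := Set.ext h.zeros
  rw [this]
  exact countable_range Z

/-- Near a simple zero `a`, `f z / (z - a)` has a continuous `m`-th root. -/
theorem exists_local_root_div (h : IsWeierstrassFunction f Z) (hm : m ≠ 0) {a : ℂ} (ha : f a = 0) :
    ∃ r : ℝ, 0 < r ∧ r ≤ 1 ∧ ∃ μ : ℂ → ℂ, ContinuousOn μ (Metric.ball a r) ∧
      ∀ z ∈ Metric.ball a r, f z = (z - a) * μ z ^ m ∧ μ z ≠ 0 := by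
  obtain ⟨k, rfl⟩ := (h.zeros a).1 ha
  -- `dslope` fills in `f z / (z - a)` by the derivative at `a`, which is nonzero for a simple zero.
  have hc : Continuous (dslope f (Z k)) := by
    rw [continuous_iff_continuousAt]
    intro z
    rcases eq_or_ne z (Z k) with rfl | hz
    · exact continuousAt_dslope_same.2 (h.entire _)
    · exact (continuousAt_dslope_of_ne hz).2 h.entire.continuous.continuousAt
  obtain ⟨r, hr, hr1, μ, hμ, hμ'⟩ := exists_local_root hc (by
    rw [dslope_same]; exact h.simple k) hm
  refine ⟨r, hr, hr1, μ, hμ, fun z hz => ⟨?_, (hμ' z hz).2⟩⟩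
  have := sub_smul_dslope f (Z k) z
  rw [(hμ' z hz).1, ← smul_eq_mul, this, ha, sub_zero]

theorem connectedSpace_regularPart (h : IsWeierstrassFunction f Z) (hm : m ≠ 0) :
    ConnectedSpace (regularPart f m) := by
  obtain ⟨r, hr, -, μ, hμ, hμ'⟩ := h.exists_local_root_div hm ((h.zeros (Z 0)).2 ⟨0, rfl⟩)
  have := preconnectedSpace_regularPart h.entire.continuous hm h.countable_zeros hr hμ hμ'
  obtain ⟨z, hz⟩ : ∃ z, f z ≠ 0 := by
    by_contra! hcon
    exact not_countable_complex (h.countable_zeros.mono fun z _ => hcon z)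
  obtain ⟨p, -⟩ := exists_regularPart hm hz
  exact { toNonempty := ⟨p⟩ }

end IsWeierstrassFunction

theorem InfiniteHyperellipticCurve.isTame {m : ℕ} (S : InfiniteHyperellipticCurve m) :
    S.atlas.IsTame := by
  have hm : m ≠ 0 := by
    have := S.two_le
    omega
  refine ⟨S.isWeierstrass.connectedSpace_regularPart hm, inferInstance, inferInstance,
    fun x hx => ?_, fun x hx => Or.inl ⟨m, S.two_le, ?_⟩⟩
  · obtain ⟨p, rfl⟩ := not_notMem.1 hx
    exact isFlatPoint_toCompletion _ hm p
  · obtain ⟨r, hr, hr1, μ, hμ, hμ'⟩ := S.isWeierstrass.exists_local_root_div hm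
      (apply_completionProj_eq_zero S.isWeierstrass.entire.continuous hm hx)
    exact isConePoint_of_completionProj_eq _ hm hr hr1 hμ hμ' rfl

open TranslationAtlas (matAct)

/-! ## Affine diffeomorphisms of lifted translation structures -/

namespace IsLocalHomeomorph

variable {Y : Type*} [TopologicalSpace Y] {D : Y → ℂ} (hD : IsLocalHomeomorph D)

/-- An affine map stretches lengths by at most `‖L‖`; the constant is raised to at least `1` because
of the cut-off. -/
theorem uniformContinuous_flatSpace_map {g : Y → Y} (hg : Continuous g) (L : ℂ →L[ℝ] ℂ) {b : ℂ}
    (hL : ∀ p, D (g p) = L (D p) + b) :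
    UniformContinuous fun p : hD.translationAtlas.FlatSpace =>
      (⟨g p.pt⟩ : hD.translationAtlas.FlatSpace) := by
  have hK : (1 : ℝ) ≤ max ‖L‖ 1 := le_max_right _ _
  refine (LipschitzWith.of_dist_le_mul (K := ⟨max ‖L‖ 1, by positivity⟩) fun p q =>
    TranslationAtlas.min_toReal_le_mul hK ?_).uniformContinuous
  rcases eq_or_ne (hD.translationAtlas.flatEDist p.pt q.pt) ∞ with h | h
  · rw [h, ENNReal.mul_top (by simp)]
    exact le_top
  · refine hD.flatEDist_map_le hD L (c := D p.pt)
      (r := (hD.translationAtlas.flatEDist p.pt q.pt).toReal + 1)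
      (δ := (hD.translationAtlas.flatEDist p.pt q.pt).toReal + 1) (by positivity) (fun z => ?_)
      hg.continuousOn (fun p _ => hL p) (by simp) ?_
    · exact (L.le_opNorm z).trans (by gcongr; exact le_max_left _ _)
    · rw [ENNReal.lt_ofReal_iff_toReal_lt h]
      linarith

/-- Both `g` and its inverse are uniformly continuous for the flat metric, so `g` extends to the
completion; being bijective there and on the image of `Y`, the extension preserves the
singularities. -/
theorem exists_isAffineDiffeo (g : Y ≃ₜ Y) (A : Matrix (Fin 2) (Fin 2) ℝ) (L : ℂ →L[ℝ] ℂ)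
    {b b' : ℂ} (hA : ∀ p, D (g p) = matAct A (D p) + b)
    (hL : ∀ p, D (g.symm p) = L (D p) + b') :
    ∃ h, hD.translationAtlas.IsAffineDiffeo A h := by
  let e : hD.translationAtlas.FlatSpace ≃ᵤ hD.translationAtlas.FlatSpace :=
    { toFun := fun p => ⟨g p.pt⟩
      invFun := fun p => ⟨g.symm p.pt⟩
      left_inv := fun p => by simp
      right_inv := fun p => by simp
      uniformContinuous_toFun := hD.uniformContinuous_flatSpace_map g.continuous
        (matAct A).toContinuousLinearMap hA
      uniformContinuous_invFun := hD.uniformContinuous_flatSpace_map g.symm.continuous L hL }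
  have he : ∀ p, UniformSpace.Completion.mapEquiv e (hD.translationAtlas.toCompletion p) =
      hD.translationAtlas.toCompletion (g p) := fun p =>
    UniformSpace.Completion.mapEquiv_coe e ⟨p⟩
  refine ⟨(UniformSpace.Completion.mapEquiv e).toHomeomorph, ?_, g, he, ?_⟩
  · rw [TranslationAtlas.sing, image_compl_eq (Homeomorph.bijective _), ← range_comp]
    congr 1
    have h1 : (UniformSpace.Completion.mapEquiv e).toHomeomorph ∘ hD.translationAtlas.toCompletion =
        hD.translationAtlas.toCompletion ∘ g := funext he
    rw [h1, g.surjective.range_comp]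
  · intro p e he e' he' hp hp'
    refine ⟨b, ?_⟩
    filter_upwards [e.open_source.mem_nhds hp,
      g.continuous.continuousAt.preimage_mem_nhds (e'.open_source.mem_nhds hp')] with q hq hq'
    rw [he q hq, he' _ hq', hA]

/-- An affine diffeomorphism of a connected surface covers one affine map of the plane. -/
theorem exists_apply_eq_of_isAffineDiffeo [PreconnectedSpace Y] {A : Matrix (Fin 2) (Fin 2) ℝ}
    {h : hD.translationAtlas.MetricCompletion ≃ₜ hD.translationAtlas.MetricCompletion}
    (hA : hD.translationAtlas.IsAffineDiffeo A h) :
    ∃ (g : Y ≃ₜ Y) (b : ℂ), ∀ p, D (g p) = matAct A (D p) + b := by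
  obtain ⟨-, g, -, hg⟩ := hA
  rcases isEmpty_or_nonempty Y with hY | ⟨⟨p₀⟩⟩
  · exact ⟨g, 0, fun p => hY.elim p⟩
  have hc : IsLocallyConstant fun p => D (g p) - matAct A (D p) := by
    rw [IsLocallyConstant.iff_eventually_eq]
    intro p
    obtain ⟨e, he, hDe⟩ := hD p
    obtain ⟨e', he', hDe'⟩ := hD (g p)
    obtain ⟨b, hb⟩ := hg p e (fun _ _ => by rw [hDe]) e' (fun _ _ => by rw [hDe']) he he'
    rw [← hDe, ← hDe'] at hb
    filter_upwards [hb] with q hq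
    rw [hq, hb.self_of_nhds]
    ring
  refine ⟨g, D (g p₀) - matAct A (D p₀), fun p => ?_⟩
  rw [← hc.apply_eq_of_preconnectedSpace p p₀]
  ring

end IsLocalHomeomorph

/-! ## Curves with zeros that are not collinear -/

theorem matAct_injective : Function.Injective matAct :=
  (Matrix.toLin Complex.basisOneI Complex.basisOneI).injective

theorem matAct_coe_glPos_injective :
    Function.Injective fun A : Matrix.GLPos (Fin 2) ℝ =>
      matAct ((A : GL (Fin 2) ℝ) : Matrix (Fin 2) (Fin 2) ℝ) :=
  fun _ _ h => Subtype.ext (Units.ext (matAct_injective h))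

theorem matAct_mul (A B : Matrix (Fin 2) (Fin 2) ℝ) (z : ℂ) :
    matAct (A * B) z = matAct A (matAct B z) := by
  rw [matAct, Matrix.toLin_mul Complex.basisOneI Complex.basisOneI Complex.basisOneI]
  rfl

theorem matAct_one (z : ℂ) : matAct 1 z = z := by
  simp [matAct]

theorem matAct_gl_injective (A : GL (Fin 2) ℝ) :
    Function.Injective (matAct (A : Matrix (Fin 2) (Fin 2) ℝ)) := by
  refine Function.LeftInverse.injective (g := matAct ((A⁻¹ : GL (Fin 2) ℝ) : Matrix _ _ ℝ))
    fun z => ?_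
  rw [← matAct_mul, ← Units.val_mul, inv_mul_cancel, Units.val_one, matAct_one]

theorem im_div_eq_zero_iff {u z : ℂ} (hu : u ≠ 0) : (z / u).im = 0 ↔ ∃ r : ℝ, z = r * u := by
  constructor
  · intro h
    refine ⟨(z / u).re, ?_⟩
    rw [← div_eq_iff hu]
    exact Complex.ext rfl (by simp [h])
  · rintro ⟨r, rfl⟩
    rw [mul_div_cancel_right₀ _ hu, Complex.ofReal_im]

/-- Real linear maps that agree at two independent vectors are equal. -/
theorem linearMap_eq_of_im_div_ne_zero {L L' : ℂ →ₗ[ℝ] ℂ} {u v : ℂ} (hu : u ≠ 0)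
    (hv : (v / u).im ≠ 0) (h1 : L u = L' u) (h2 : L v = L' v) : L = L' := by
  refine LinearMap.ext fun z => ?_
  set β : ℝ := (z / u).im / (v / u).im with hβ
  obtain ⟨α, hα⟩ := (im_div_eq_zero_iff (z := z - β * v) hu).1 (by
    rw [sub_div, mul_div_assoc, Complex.sub_im, Complex.im_ofReal_mul, hβ,
      div_mul_cancel₀ _ hv, sub_self])
  have hz : z = α • u + β • v := by
    rw [Complex.real_smul, Complex.real_smul, ← hα, sub_add_cancel]
  rw [hz, map_add, map_add, map_smul, map_smul, map_smul, map_smul, h1, h2]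

theorem collinear_range_of_im_div_eq_zero {Z : ℕ → ℂ} {u : ℂ} (hu : u ≠ 0)
    (h : ∀ k, ((Z k - Z 0) / u).im = 0) : Collinear ℝ (range Z) := by
  rw [collinear_iff_exists_forall_eq_smul_vadd]
  refine ⟨Z 0, u, ?_⟩
  rintro _ ⟨k, rfl⟩
  obtain ⟨r, hr⟩ := (im_div_eq_zero_iff hu).1 (h k)
  exact ⟨r, by rw [vadd_eq_add, Complex.real_smul, ← hr, sub_add_cancel]⟩

namespace InfiniteHyperellipticCurve

theorem ne_zero {m : ℕ} (S : InfiniteHyperellipticCurve m) : m ≠ 0 := by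
  have := S.two_le
  omega

variable {m : ℕ} (S : InfiniteHyperellipticCurve m)

/-- The zeros are exactly the points missed by the projection. If the image of a zero were not a
zero, surjectivity of `g` and injectivity of `A` would give a regular point over a zero. -/
theorem exists_affine_of_mem_veechGroup {A : Matrix.GLPos (Fin 2) ℝ} (hA : A ∈ S.veechGroup) :
    ∃ b : ℂ, ∀ k, matAct ((A : GL (Fin 2) ℝ) : Matrix (Fin 2) (Fin 2) ℝ) (S.Z.1 k) + b ∈
      range S.Z.1 := by
  obtain ⟨h, hh⟩ := hA
  have := S.isWeierstrass.connectedSpace_regularPart S.ne_zero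
  obtain ⟨g, b, hg⟩ := (isLocalHomeomorph_curveProj S.isWeierstrass.entire.continuous
    S.ne_zero).exists_apply_eq_of_isAffineDiffeo hh
  refine ⟨b, fun k => ?_⟩
  rw [← S.isWeierstrass.zeros]
  by_contra hne
  obtain ⟨q, hq⟩ := exists_regularPart S.ne_zero hne
  obtain ⟨p, rfl⟩ := g.surjective q
  rw [hg] at hq
  have h1 := matAct_gl_injective _ (add_right_cancel hq)
  exact apply_curveProj_ne_zero p (by rw [h1, S.isWeierstrass.zeros]; exact ⟨k, rfl⟩)

/-- Three noncollinear zeros have only countably many possible triples of images, and such a triple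
determines the linear part. -/
theorem countable_veechGroup (hZ : ¬ Collinear ℝ (range S.Z.1)) : Countable S.veechGroup := by
  have hu : S.Z.1 1 - S.Z.1 0 ≠ 0 := sub_ne_zero.2 fun h => one_ne_zero (S.Z.2.1 h)
  obtain ⟨k, hk⟩ : ∃ k, ((S.Z.1 k - S.Z.1 0) / (S.Z.1 1 - S.Z.1 0)).im ≠ 0 := by
    by_contra! hcon
    exact hZ (collinear_range_of_im_div_eq_zero hu hcon)
  choose b j hj using fun A : S.veechGroup => S.exists_affine_of_mem_veechGroup A.2
  refine Function.Injective.countable (f := fun A => (j A 0, j A 1, j A k)) fun A B hAB => ?_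
  simp only [Prod.mk.injEq] at hAB
  obtain ⟨h0, h1, hk'⟩ := hAB
  have e0 := (hj A 0).symm.trans ((congrArg S.Z.1 h0).trans (hj B 0))
  have e1 := (hj A 1).symm.trans ((congrArg S.Z.1 h1).trans (hj B 1))
  have ek := (hj A k).symm.trans ((congrArg S.Z.1 hk').trans (hj B k))
  -- Differences of zeros cancel the translation parts, which may differ for `A` and `B`.
  refine Subtype.ext (matAct_coe_glPos_injective (linearMap_eq_of_im_div_ne_zero hu hk ?_ ?_))
  · rw [map_sub, map_sub]
    linear_combination e1 - e0
  · rw [map_sub, map_sub]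
    linear_combination ek - e0

end InfiniteHyperellipticCurve

/-! ## Shears -/

/-- The shear `z ↦ z + t Im (z / u) u` along the real line spanned by `u`. -/
def shear (u : ℂ) (t : ℝ) : ℂ →ₗ[ℝ] ℂ where
  toFun z := z + (t * (z / u).im : ℝ) * u
  map_add' z z' := by
    simp only [add_div, Complex.add_im, mul_add, Complex.ofReal_add]
    ring
  map_smul' r z := by
    simp only [Complex.real_smul, mul_div_assoc, Complex.im_ofReal_mul, RingHom.id_apply,
      Complex.ofReal_mul]
    ring

theorem shear_apply (u : ℂ) (t : ℝ) (z : ℂ) : shear u t z = z + (t * (z / u).im : ℝ) * u := rfl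

theorem im_shear_div {u : ℂ} (hu : u ≠ 0) (t : ℝ) (z : ℂ) : (shear u t z / u).im = (z / u).im := by
  rw [shear_apply, add_div, mul_div_cancel_right₀ _ hu, Complex.add_im, Complex.ofReal_im, add_zero]

theorem shear_shear {u : ℂ} (hu : u ≠ 0) (s t : ℝ) (z : ℂ) :
    shear u s (shear u t z) = shear u (s + t) z := by
  rw [shear_apply u s, im_shear_div hu, shear_apply, shear_apply]
  push_cast
  ring

theorem shear_zero (u z : ℂ) : shear u 0 z = z := by
  simp [shear_apply]

/-- The matrix of a shear. -/
def shearMatrix (u : ℂ) (t : ℝ) : Matrix (Fin 2) (Fin 2) ℝ :=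
  LinearMap.toMatrix Complex.basisOneI Complex.basisOneI (shear u t)

theorem matAct_shearMatrix (u : ℂ) (t : ℝ) : matAct (shearMatrix u t) = shear u t :=
  Matrix.toLin_toMatrix _ _ _

theorem shearMatrix_mul {u : ℂ} (hu : u ≠ 0) (s t : ℝ) :
    shearMatrix u s * shearMatrix u t = shearMatrix u (s + t) := by
  rw [shearMatrix, shearMatrix, ← LinearMap.toMatrix_comp]
  exact congrArg _ (LinearMap.ext (shear_shear hu s t))

theorem shearMatrix_zero (u : ℂ) : shearMatrix u 0 = 1 := by
  rw [shearMatrix, ← LinearMap.toMatrix_id Complex.basisOneI]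
  exact congrArg _ (LinearMap.ext (shear_zero u))

theorem exists_glPos_eq_shearMatrix {u : ℂ} (hu : u ≠ 0) (t : ℝ) :
    ∃ A : Matrix.GLPos (Fin 2) ℝ,
      ((A : GL (Fin 2) ℝ) : Matrix (Fin 2) (Fin 2) ℝ) = shearMatrix u t := by
  have hinv : ∀ s, shearMatrix u s * shearMatrix u (-s) = 1 := fun s => by
    rw [shearMatrix_mul hu, add_neg_cancel, shearMatrix_zero]
  -- The shear by `t` is the square of the invertible shear by `t / 2`, so its determinant is
  -- positive.
  have hpos : 0 < (shearMatrix u t).det := by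
    have h1 : (shearMatrix u (t / 2)).det ≠ 0 := fun h0 => by
      have := congrArg Matrix.det (hinv (t / 2))
      rw [Matrix.det_mul, h0, zero_mul, Matrix.det_one] at this
      exact zero_ne_one this
    rw [← add_halves t, ← shearMatrix_mul hu, Matrix.det_mul]
    exact mul_self_pos.2 h1
  exact ⟨⟨⟨shearMatrix u t, shearMatrix u (-t), hinv t, by simpa using hinv (-t)⟩, hpos⟩, rfl⟩

theorem shearMatrix_injective {u : ℂ} (hu : u ≠ 0) : Function.Injective (shearMatrix u) := by
  intro s t h
  have h1 := congrArg (fun A => matAct A (Complex.I * u)) h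
  simp only [matAct_shearMatrix, shear_apply, mul_div_cancel_right₀ _ hu, Complex.I_im,
    mul_one] at h1
  exact_mod_cast mul_right_cancel₀ hu (add_left_cancel h1)

/-! ## Curves with collinear zeros -/

section Lift

variable {f : ℂ → ℂ} {u p : ℂ}

/-- The shear that fixes the real line through `p` in the direction `u`. -/
def affineShear (u p : ℂ) (t : ℝ) (z : ℂ) : ℂ := p + shear u t (z - p)

theorem affineShear_eq (u p : ℂ) (t : ℝ) (z : ℂ) :
    affineShear u p t z = z + t * ((((z - p) / u).im : ℝ) * u) := by
  rw [affineShear, shear_apply]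
  push_cast
  ring

theorem affineShear_affineShear (hu : u ≠ 0) (s t : ℝ) (z : ℂ) :
    affineShear u p s (affineShear u p t z) = affineShear u p (s + t) z := by
  rw [affineShear, affineShear, add_sub_cancel_left, shear_shear hu, affineShear]

theorem affineShear_zero (z : ℂ) : affineShear u p 0 z = z := by
  simp [affineShear_eq]

/-- The shear preserves the height `Im ((z - p) / u)`. A point moved onto a zero has height `0`,
hence was fixed. -/
theorem apply_affineShear_ne_zero (hu : u ≠ 0) (hf : ∀ z, f z = 0 → ((z - p) / u).im = 0)
    {z : ℂ} (hz : f z ≠ 0) (t : ℝ) : f (affineShear u p t z) ≠ 0 := by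
  intro h0
  have h1 := hf _ h0
  rw [affineShear, add_sub_cancel_left, im_shear_div hu] at h1
  rw [affineShear_eq, h1, Complex.ofReal_zero, zero_mul, mul_zero, add_zero] at h0
  exact hz h0

/-- The derivative of `t ↦ log (f (z_t))` along the flow line `z_t` of the shears. -/
def shearLogDeriv (f : ℂ → ℂ) (u p z : ℂ) (s : ℝ) : ℂ :=
  (((z - p) / u).im : ℝ) * u * (deriv f (affineShear u p s z) / f (affineShear u p s z))

/-- The continuous branch of `log (f (z_t) / f z)` along the flow line `z_t` of the shears. -/
def shearLog (f : ℂ → ℂ) (u p : ℂ) (t : ℝ) (z : ℂ) : ℂ :=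
  ∫ s in (0 : ℝ)..t, shearLogDeriv f u p z s

theorem continuous_affineShear_uncurry : Continuous fun q : ℂ × ℝ => affineShear u p q.2 q.1 := by
  simp only [affineShear_eq]
  fun_prop

theorem continuous_shearLogDeriv (hfd : Differentiable ℂ f) (hu : u ≠ 0)
    (hf : ∀ z, f z = 0 → ((z - p) / u).im = 0) :
    Continuous fun q : {z // f z ≠ 0} × ℝ => shearLogDeriv f u p q.1 q.2 := by
  have h1 : Continuous fun q : {z // f z ≠ 0} × ℝ => affineShear u p q.2 q.1 :=
    continuous_affineShear_uncurry.comp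
      ((continuous_subtype_val.comp continuous_fst).prodMk continuous_snd)
  have h2 : Continuous (deriv f) := hfd.contDiff.continuous_deriv (n := 1) le_rfl
  refine Continuous.mul (by fun_prop) ((h2.comp h1).div (hfd.continuous.comp h1) fun q => ?_)
  exact apply_affineShear_ne_zero hu hf q.1.2 q.2

theorem continuous_shearLog (hfd : Differentiable ℂ f) (hu : u ≠ 0)
    (hf : ∀ z, f z = 0 → ((z - p) / u).im = 0) (t : ℝ) :
    Continuous fun z : {z // f z ≠ 0} => shearLog f u p t z := by
  refine intervalIntegral.continuous_parametric_intervalIntegral_of_continuous'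
    (f := fun (z : {z // f z ≠ 0}) (s : ℝ) => shearLogDeriv f u p z s) ?_ 0 t
  exact continuous_shearLogDeriv hfd hu hf

/-- The function `s ↦ exp (-shearLog) * f z_s` has derivative zero along the flow line and equals `f
z` at `s = 0`. -/
theorem exp_shearLog (hfd : Differentiable ℂ f) (hu : u ≠ 0)
    (hf : ∀ z, f z = 0 → ((z - p) / u).im = 0) (t : ℝ) {z : ℂ} (hz : f z ≠ 0) :
    Complex.exp (shearLog f u p t z) = f (affineShear u p t z) / f z := by
  have hI : ∀ s, HasDerivAt (fun s => shearLog f u p s z) (shearLogDeriv f u p z s) s := by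
    intro s
    have h1 : Continuous fun s : ℝ => ((⟨z, hz⟩, s) : {z // f z ≠ 0} × ℝ) := by fun_prop
    have h2 := (continuous_shearLogDeriv hfd hu hf).comp h1
    have hc : Continuous (shearLogDeriv f u p z) := h2
    exact intervalIntegral.integral_hasDerivAt_right (hc.intervalIntegrable _ _)
      (hc.stronglyMeasurableAtFilter _ _) hc.continuousAt
  have hS : ∀ s, HasDerivAt (fun s => f (affineShear u p s z))
      (deriv f (affineShear u p s z) * ((((z - p) / u).im : ℝ) * u)) s := by
    intro s
    have h1 : HasDerivAt (fun s : ℝ => affineShear u p s z) ((((z - p) / u).im : ℝ) * u) s := by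
      simp only [affineShear_eq]
      simpa using ((Complex.ofRealCLM.hasDerivAt (x := s)).mul_const
        ((((z - p) / u).im : ℝ) * u)).const_add z
    exact (hfd (affineShear u p s z)).hasDerivAt.comp s h1
  have hd : ∀ s, HasDerivAt (fun s => Complex.exp (-shearLog f u p s z) * f (affineShear u p s z))
      0 s := by
    intro s
    refine (((hI s).neg.cexp).mul (hS s)).congr_deriv ?_
    have := apply_affineShear_ne_zero hu hf hz s
    simp only [shearLogDeriv]
    field_simp
    ring
  have hconst := is_const_of_deriv_eq_zero (fun s => (hd s).differentiableAt)
    (fun s => (hd s).deriv) t 0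
  have h0 : shearLog f u p 0 z = 0 := intervalIntegral.integral_same
  rw [h0, neg_zero, Complex.exp_zero, one_mul, affineShear_zero] at hconst
  rw [eq_div_iff hz, ← hconst, ← mul_assoc, ← Complex.exp_add, add_neg_cancel, Complex.exp_zero,
    one_mul]

/-- The same flow line is traversed backwards. This makes the lifts of opposite shears inverse on
the curve, without an ambiguity by roots of unity. -/
theorem shearLog_affineShear (hu : u ≠ 0) (t : ℝ) (z : ℂ) :
    shearLog f u p (-t) (affineShear u p t z) = -shearLog f u p t z := by
  have h1 : ((affineShear u p t z - p) / u).im = ((z - p) / u).im := by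
    rw [affineShear, add_sub_cancel_left, im_shear_div hu]
  simp only [shearLog, shearLogDeriv, affineShear_affineShear hu, h1]
  rw [intervalIntegral.integral_comp_add_right (fun s : ℝ => (((z - p) / u).im : ℝ) * u *
    (deriv f (affineShear u p s z) / f (affineShear u p s z))) t, zero_add, neg_add_cancel,
    intervalIntegral.integral_symm]

variable {m : ℕ}

/-- The lift of a shear to the curve. -/
def shearLift (hfd : Differentiable ℂ f) (hm : m ≠ 0) (hu : u ≠ 0)
    (hf : ∀ z, f z = 0 → ((z - p) / u).im = 0) (t : ℝ) (q : regularPart f m) : regularPart f m :=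
  ⟨(affineShear u p t (curveProj f m q),
    q.1.2 * Complex.exp (shearLog f u p t (curveProj f m q) / m)), by
    refine ⟨?_, mul_ne_zero (regularPart_snd_ne_zero q) (Complex.exp_ne_zero _)⟩
    have hq := apply_curveProj_ne_zero q
    change (q.1.2 * Complex.exp (shearLog f u p t (curveProj f m q) / m)) ^ m =
      f (affineShear u p t (curveProj f m q))
    rw [mul_pow, ← Complex.exp_nat_mul, mul_div_cancel₀ _ (Nat.cast_ne_zero.2 hm),
      exp_shearLog hfd hu hf t hq, regularPart_pow_eq, mul_div_cancel₀ _ hq]⟩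

theorem continuous_shearLift (hfd : Differentiable ℂ f) (hm : m ≠ 0) (hu : u ≠ 0)
    (hf : ∀ z, f z = 0 → ((z - p) / u).im = 0) (t : ℝ) :
    Continuous (shearLift (m := m) hfd hm hu hf t) := by
  refine Continuous.subtype_mk (Continuous.prodMk ?_ (Continuous.mul ?_ ?_)) _
  · exact continuous_affineShear_uncurry.comp (continuous_curveProj.prodMk continuous_const)
  · exact continuous_snd.comp continuous_subtype_val
  · have := (continuous_shearLog hfd hu hf t).comp
      ((continuous_curveProj (f := f) (m := m)).subtype_mk apply_curveProj_ne_zero)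
    exact (this.div_const _).cexp

theorem shearLift_neg_shearLift (hfd : Differentiable ℂ f) (hm : m ≠ 0) (hu : u ≠ 0)
    (hf : ∀ z, f z = 0 → ((z - p) / u).im = 0) (t : ℝ) (q : regularPart f m) :
    shearLift hfd hm hu hf (-t) (shearLift hfd hm hu hf t q) = q := by
  refine Subtype.ext (Prod.ext ?_ ?_)
  · change affineShear u p (-t) (affineShear u p t (curveProj f m q)) = curveProj f m q
    rw [affineShear_affineShear hu, neg_add_cancel, affineShear_zero]
  · change q.1.2 * Complex.exp (shearLog f u p t (curveProj f m q) / m) *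
      Complex.exp (shearLog f u p (-t) (affineShear u p t (curveProj f m q)) / m) = q.1.2
    rw [shearLog_affineShear hu, mul_assoc, ← Complex.exp_add, neg_div, add_neg_cancel,
      Complex.exp_zero, mul_one]

/-- The lift of a shear to the curve, as a homeomorphism. -/
def shearLiftHomeomorph (hfd : Differentiable ℂ f) (hm : m ≠ 0) (hu : u ≠ 0)
    (hf : ∀ z, f z = 0 → ((z - p) / u).im = 0) (t : ℝ) : regularPart f m ≃ₜ regularPart f m where
  toFun := shearLift hfd hm hu hf t
  invFun := shearLift hfd hm hu hf (-t)
  left_inv := shearLift_neg_shearLift hfd hm hu hf t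
  right_inv q := by simpa using shearLift_neg_shearLift hfd hm hu hf (-t) q
  continuous_toFun := continuous_shearLift hfd hm hu hf t
  continuous_invFun := continuous_shearLift hfd hm hu hf (-t)

end Lift

namespace InfiniteHyperellipticCurve

variable {m : ℕ} (S : InfiniteHyperellipticCurve m)

/-- The shears along the line of zeros all lift, and distinct parameters in `ℝ` give distinct
matrices. -/
theorem uncountable_veechGroup (hZ : Collinear ℝ (range S.Z.1)) : Uncountable S.veechGroup := by
  obtain ⟨p, u, hpu⟩ := (collinear_iff_exists_forall_eq_smul_vadd _).1 hZ
  have hu : u ≠ 0 := by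
    rintro rfl
    obtain ⟨r, hr⟩ := hpu _ ⟨0, rfl⟩
    obtain ⟨r', hr'⟩ := hpu _ ⟨1, rfl⟩
    rw [smul_zero, ← smul_zero r, ← hr] at hr'
    exact one_ne_zero (S.Z.2.1 hr')
  have hf : ∀ z, S.f z = 0 → ((z - p) / u).im = 0 := by
    intro z hz
    obtain ⟨r, hr⟩ := hpu z ((S.isWeierstrass.zeros z).1 hz)
    rw [im_div_eq_zero_iff hu]
    exact ⟨r, by rw [hr, vadd_eq_add, add_sub_cancel_right, Complex.real_smul]⟩
  choose A hA using exists_glPos_eq_shearMatrix hu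
  have hmem : ∀ t, A t ∈ S.veechGroup := by
    intro t
    refine (isLocalHomeomorph_curveProj S.isWeierstrass.entire.continuous
      S.ne_zero).exists_isAffineDiffeo
        (shearLiftHomeomorph S.isWeierstrass.entire S.ne_zero hu hf t) _
        (shear u (-t)).toContinuousLinearMap (b := p - shear u t p) (b' := p - shear u (-t) p)
        (fun q => ?_) fun q => ?_
    · rw [hA, matAct_shearMatrix]
      change affineShear u p t (curveProj S.f m q) = _
      rw [affineShear, map_sub]
      ring
    · change affineShear u p (-t) (curveProj S.f m q) = shear u (-t) (curveProj S.f m q) + _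
      rw [affineShear, map_sub]
      ring
  refine Function.Injective.uncountable (f := fun t : ℝ => (⟨A t, hmem t⟩ : S.veechGroup)) ?_
  intro s t h
  refine shearMatrix_injective hu ?_
  have h' : A s = A t := congrArg Subtype.val h
  rw [← hA, ← hA, h']

theorem uncountable_veechGroup_iff : Uncountable S.veechGroup ↔ Collinear ℝ (range S.Z.1) := by
  refine ⟨fun h => ?_, S.uncountable_veechGroup⟩
  by_contra hZ
  exact not_countable_iff.2 h (S.countable_veechGroup hZ)

end InfiniteHyperellipticCurve

/-! ## The moduli space -/

theorem collinear_range_add_const_iff (Z : ℕ → ℂ) (b : ℂ) :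
    Collinear ℝ (range fun k => Z k + b) ↔ Collinear ℝ (range Z) := by
  have key : ∀ (Z : ℕ → ℂ) (b : ℂ), Collinear ℝ (range Z) →
      Collinear ℝ (range fun k => Z k + b) := by
    intro Z b h
    obtain ⟨p, u, hpu⟩ := (collinear_iff_exists_forall_eq_smul_vadd _).1 h
    refine (collinear_iff_exists_forall_eq_smul_vadd _).2 ⟨p + b, u, ?_⟩
    rintro _ ⟨k, rfl⟩
    obtain ⟨r, hr⟩ := hpu _ ⟨k, rfl⟩
    refine ⟨r, ?_⟩
    simp only [hr, vadd_eq_add, add_assoc]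
  refine ⟨fun h => ?_, key Z b⟩
  simpa using key _ (-b) h

/-- The collinear sequences in `𝒞₀` lie on lines through `0`, which inversion maps to lines. -/
theorem CZero.collinear_range_inv (w : CZero) (h : Collinear ℝ (range fun k => w.1 k)) :
    Collinear ℝ (range fun k => (w.1 k)⁻¹) := by
  obtain ⟨p, u, hpu⟩ := (collinear_iff_exists_forall_eq_smul_vadd _).1 h
  have hu : u ≠ 0 := by
    rintro rfl
    obtain ⟨r, hr⟩ := hpu _ ⟨0, rfl⟩
    obtain ⟨r', hr'⟩ := hpu _ ⟨1, rfl⟩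
    rw [smul_zero, ← smul_zero r, ← hr] at hr'
    exact one_ne_zero (w.2.1 hr')
  have him : ∀ k, (w.1 k / u).im = (p / u).im := by
    intro k
    obtain ⟨r, hr⟩ := hpu _ ⟨k, rfl⟩
    simp only [hr, vadd_eq_add, Complex.real_smul, add_div, mul_div_cancel_right₀ _ hu,
      Complex.add_im, Complex.ofReal_im, zero_add]
  -- The height of the line is constant along the sequence and tends to `0`, so the line passes
  -- through `0`.
  have h0 : (p / u).im = 0 := by
    have h1 : Tendsto (fun k => (w.1 k / u).im) atTop (𝓝 ((0 / u : ℂ)).im) :=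
      (Complex.continuous_im.tendsto _).comp (w.2.2.2.div_const u)
    simp only [him, zero_div, Complex.zero_im] at h1
    exact tendsto_nhds_unique tendsto_const_nhds h1
  refine (collinear_iff_exists_forall_eq_smul_vadd _).2 ⟨0, u⁻¹, ?_⟩
  rintro _ ⟨k, rfl⟩
  obtain ⟨r, hr⟩ := (im_div_eq_zero_iff hu).1 ((him k).trans h0)
  exact ⟨r⁻¹, by simp [hr, mul_comm]⟩

theorem CInfty.exists_representative_of_ne_zero (Z : CInfty) {b : ℂ} (hb : ∀ k, Z.1 k + b ≠ 0) :
    ∃ w : CZero, ∀ k, w.1 k = (Z.1 k + b)⁻¹ := by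
  have hlim : Tendsto (fun k => (Z.1 k + b)⁻¹) atTop (𝓝 0) := by
    refine tendsto_inv₀_cobounded.comp ?_
    rw [← tendsto_norm_atTop_iff_cobounded]
    exact tendsto_norm_add_const_atTop Z.2.2 b
  exact ⟨⟨⟨fun k => (Z.1 k + b)⁻¹, memℓp_infty hlim.norm.bddAbove_range⟩,
    fun j k h => Z.2.1 (add_right_cancel (inv_injective h)), fun k => inv_ne_zero (hb k), hlim⟩,
    fun k => rfl⟩

theorem CInfty.moduliClass_mem_collinearClasses_iff (Z : CInfty) :
    CInfty.moduliClass Z ∈ collinearClasses ↔ Collinear ℝ (range Z.1) := by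
  constructor
  · rintro ⟨w, hw, hc⟩
    obtain ⟨b, hb⟩ := (CInfty.mk_eq_moduliClass_iff Z w).1 hw
    rw [← collinear_range_add_const_iff Z.1 b, ← funext hb]
    exact CZero.collinear_range_inv w hc
  · intro h
    obtain ⟨p, u, hpu⟩ := (collinear_iff_exists_forall_eq_smul_vadd _).1 h
    choose r hr using fun k => hpu _ ⟨k, rfl⟩
    have hu : u ≠ 0 := by
      rintro rfl
      have := (hr 0).trans (by simpa using (hr 1).symm)
      exact zero_ne_one (Z.2.1 this)
    -- The origin is moved to a point of the line that is not a zero. The line then passes through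
    -- `0`, so the inverses stay collinear.
    obtain ⟨s, hs⟩ : ∃ s : ℝ, s ∉ range r := by
      by_contra! hcon
      exact Cardinal.not_countable_real ((countable_range r).mono fun s _ => hcon s)
    have hZ : ∀ k, Z.1 k + -(s * u + p) = (r k - s : ℝ) * u := by
      intro k
      rw [hr k, vadd_eq_add, Complex.real_smul]
      push_cast
      ring
    obtain ⟨w, hw⟩ := CInfty.exists_representative_of_ne_zero Z (b := -(s * u + p)) fun k => by
      rw [hZ]
      exact mul_ne_zero (Complex.ofReal_ne_zero.2 (sub_ne_zero.2 fun h => hs ⟨k, h⟩)) hu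
    refine ⟨w, (CInfty.mk_eq_moduliClass_iff Z w).2 ⟨_, fun k => by rw [hw k, inv_inv]⟩, ?_⟩
    refine (collinear_iff_exists_forall_eq_smul_vadd _).2 ⟨0, u⁻¹, ?_⟩
    rintro _ ⟨k, rfl⟩
    refine ⟨(r k - s)⁻¹, ?_⟩
    beta_reduce
    rw [hw, hZ, mul_inv, vadd_eq_add, add_zero, Complex.real_smul, Complex.ofReal_inv]

theorem CInfty.exists_moduliClass_eq (c : ModuliSpace) :
    ∃ Z : CInfty, CInfty.moduliClass Z = c := by
  obtain ⟨w, rfl⟩ := Quotient.exists_rep c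
  have hlim : Tendsto (fun k => ‖(w.1 k)⁻¹‖) atTop atTop := by
    rw [tendsto_norm_atTop_iff_cobounded]
    refine tendsto_inv₀_nhdsNE_zero.comp ?_
    exact tendsto_nhdsWithin_iff.2 ⟨w.2.2.2, Eventually.of_forall w.2.2.1⟩
  refine ⟨⟨fun k => (w.1 k)⁻¹, fun j k h => w.2.1 (inv_injective h), hlim⟩, Eq.symm ?_⟩
  exact (CInfty.mk_eq_moduliClass_iff _ w).2 ⟨0, fun k => (add_zero _).symm⟩

theorem InfiniteHyperellipticCurve.exists_moduliClass_eq {m : ℕ} (hm : 2 ≤ m) (c : ModuliSpace) :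
    ∃ S : InfiniteHyperellipticCurve m, S.moduliClass = c := by
  obtain ⟨Z, rfl⟩ := CInfty.exists_moduliClass_eq c
  obtain ⟨f, hf⟩ := exists_isWeierstrassFunction Z
  exact ⟨⟨Z, f, hf, hm⟩, rfl⟩

/-- Both conditions amount to collinearity of the zeros, so all curves with the same class fall on
the same side of the dichotomy, whatever `f` is. -/
theorem InfiniteHyperellipticCurve.moduliClass_mem_collinearClasses_iff {m : ℕ}
    (S : InfiniteHyperellipticCurve m) :
    S.moduliClass ∈ collinearClasses ↔ Uncountable S.veechGroup :=
  (CInfty.moduliClass_mem_collinearClasses_iff S.Z).trans S.uncountable_veechGroup_iff.symm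

end

/-! ### Main theorem: tameness and the dichotomy of Veech groups -/

theorem theoremt (m : ℕ) (hm : 2 ≤ m) :
    (∀ S : InfiniteHyperellipticCurve m, S.atlas.IsTame) ∧
    collinearClasses =
      InfiniteHyperellipticCurve.moduliClass ''
        {S : InfiniteHyperellipticCurve m | Uncountable S.veechGroup} ∧
    collinearClassesᶜ =
      InfiniteHyperellipticCurve.moduliClass ''
        {S : InfiniteHyperellipticCurve m | Countable S.veechGroup} := by
  refine ⟨InfiniteHyperellipticCurve.isTame, Set.ext fun c => ⟨fun hc => ?_, ?_⟩,
    Set.ext fun c => ⟨fun hc => ?_, ?_⟩⟩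
  · obtain ⟨S, rfl⟩ := InfiniteHyperellipticCurve.exists_moduliClass_eq hm c
    exact ⟨S, S.moduliClass_mem_collinearClasses_iff.1 hc, rfl⟩
  · rintro ⟨S, hS, rfl⟩
    exact S.moduliClass_mem_collinearClasses_iff.2 hS
  · obtain ⟨S, rfl⟩ := InfiniteHyperellipticCurve.exists_moduliClass_eq hm c
    refine ⟨S, ?_, rfl⟩
    rwa [mem_compl_iff, S.moduliClass_mem_collinearClasses_iff, not_uncountable_iff] at hc
  · rintro ⟨S, hS, rfl⟩
    rw [mem_compl_iff, S.moduliClass_mem_collinearClasses_iff, not_uncountable_iff]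
    exact hS
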